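/- Let $G$ be a (real, finite-dimensional) Lie group with Lie algebra $\mathfrak g$, let $H\subset G$ be a closed subgroup with Lie algebra $\mathfrak h$, and let $G/H$ carry its canonical manifold structure, with origin $o=eH$. Let $\tilde a$ be a $G$-invariant Riemannian metric and $X$ a $G$-invariant vector field on $G/H$. Let $b_0$ be a real number such that $\sqrt{\tilde a(X,X)}<b_0$ at every point, and let $\varphi$ be a positive $C^\infty$ function on $(-b_0,b_0)$ with $\varphi(s)-s\varphi'(s)+(b^2-s^2)\varphi''(s)>0$ whenever $|s|\le b<b_0$. Let $$F(x,y)=\alpha(x,y)\,\varphi\!\left(\frac{\tilde a(X(x),y)}{\alpha(x,y)}\right),\qquad \alpha(x,y)=\sqrt{\tilde a(y,y)},$$ be the resulting invariant $(\alpha,\beta)$-metric. Assume that the Chern connection of $F$ coincides with the Levi-Civita connection of $\tilde a$, and that $\varphi'(r)\neq 0$, where $r=\tilde a(X,y)/\sqrt{\tilde a(y,y)}$, for all $0\ne y\in T_o(G/H)$. Given an $\mathrm{Ad}(H)$-invariant decomposition $\mathfrak g=\mathfrak h\oplus\mathfrak m$, write $[\cdot,\cdot]_{\mathfrak m}$ for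 the $\mathfrak m$-component of the bracket and identify $\mathfrak m$ with $T_o(G/H)$ by the differential of the projection $G\to G/H$. For $0\neq y\in\mathfrak m$ put $g_y(u,v)=\frac12\frac{\partial^2}{\partial s\partial t}F^2(y+su+tv)\big|_{s=t=0}$ and $C_y(z,u,v)=\frac14\frac{\partial^3}{\partial s\partial t\partial h}F^2(y+sz+tu+hv)\big|_{s=t=h=0}$. The space $(G/H,\tilde a)$ is called naturally reductive if there is such a decomposition with $$\tilde a([x,y]_{\mathfrak m},z)+\tilde a(y,[x,z]_{\mathfrak m})=0\quad\text{for all }x,y,z\in\mathfrak m,\tag{1}$$ and $(G/H,F)$ is called naturally reductive (in the sense of Latifi) if there is such a decomposition with $$g_y([x,u]_{\mathfrak m},v)+g_y(u,[x,v]_{\mathfrak m})+2C_y([x,y]_{\mathfrak m},u,v)=0\quad\text{for all }x,u,v\in\mathfrak m,\ 0\ne y\in\mathfrak m.$$ Then $(G/H,F)$ is naturally reductive in the sense of Latifi if and only if $(G/H,\tilde a)$ is naturally reductive. Moreover, for every $\mathrm{Ad}(H)$-invariant decomposition $\mathfrak g=\mathfrak h\oplus\mathfrak m$ that satisfies (1),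 one has $\tilde a(X,[y,z]_{\mathfrak m})=0$ for all $y,z\in\mathfrak m$. -/

import Mathlib

open scoped Manifold ContDiff Bundle

noncomputable section

namespace HomogeneousFinsler

/-! ### Minkowski data on a vector space -/

section VectorSpace

variable {V : Type*} [AddCommGroup V] [Module ℝ V]

/-- The fundamental tensor `g_y(u,v) = ½ ∂²/∂s∂t F²(y + s u + t v)` at `s = t = 0`. -/
def fundamentalTensor (F : V → ℝ) (y u v : V) : ℝ :=
  (1 / 2) * deriv (fun s : ℝ => deriv (fun t : ℝ => F (y + s • u + t • v) ^ 2) 0) 0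

/-- The Cartan tensor `C_y(z,u,v) = ¼ ∂³/∂s∂t∂h F²(y + s z + t u + h v)` at `s = t = h = 0`. -/
def cartanTensor (F : V → ℝ) (y z u v : V) : ℝ :=
  (1 / 4) * deriv (fun s : ℝ => deriv (fun t : ℝ => deriv (fun h : ℝ =>
    F (y + s • z + t • u + h • v) ^ 2) 0) 0) 0

end VectorSpace

/-! ### `(α,β)`-metrics and connections on a manifold -/

section Manifold

variable {E : Type*} [NormedAddCommGroup E] [NormedSpace ℝ E]
  {M : Type*} [TopologicalSpace M] [ChartedSpace E M] [IsManifold 𝓘(ℝ, E) ∞ M]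

/-- Smooth Riemannian metrics on `M`. -/
abbrev RiemannianMetricOn (E : Type*) [NormedAddCommGroup E] [NormedSpace ℝ E]
    (M : Type*) [TopologicalSpace M] [ChartedSpace E M] [IsManifold 𝓘(ℝ, E) ∞ M] : Type _ :=
  Bundle.ContMDiffRiemannianMetric 𝓘(ℝ, E) ∞ E (TangentSpace 𝓘(ℝ, E) : M → Type _)

/-- The condition on the function `φ` that defines an `(α,β)`-metric: it is smooth and positive
on `(-b₀, b₀)`, and `φ(s) - s φ'(s) + (b² - s²) φ''(s) > 0` whenever `|s| ≤ b < b₀`. -/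
structure IsAlphaBetaFunction (φ : ℝ → ℝ) (b₀ : ℝ) : Prop where
  smooth : ContDiffOn ℝ ∞ φ (Set.Ioo (-b₀) b₀)
  pos : ∀ s ∈ Set.Ioo (-b₀) b₀, 0 < φ s
  convex : ∀ s b : ℝ, |s| ≤ b → b < b₀ →
    0 < φ s - s * deriv φ s + (b ^ 2 - s ^ 2) * deriv (deriv φ) s

/-- The quantity `r = ã(X, y) / √ã(y, y)` for a tangent vector `y` at `x`. -/
def betaRatio (a : RiemannianMetricOn E M) (X : (x : M) → TangentSpace 𝓘(ℝ, E) x) (x : M)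
    (y : TangentSpace 𝓘(ℝ, E) x) : ℝ :=
  a.inner x (X x) y / √(a.inner x y y)

/-- The function `F(x, y) = α(x, y) φ(ã(X(x), y) / α(x, y))` with `α(x, y) = √ã(y, y)`. -/
def alphaBetaMetric (a : RiemannianMetricOn E M) (X : (x : M) → TangentSpace 𝓘(ℝ, E) x)
    (φ : ℝ → ℝ) (x : M) (y : TangentSpace 𝓘(ℝ, E) x) : ℝ :=
  √(a.inner x y y) * φ (betaRatio a X x y)

variable [FiniteDimensional ℝ E]

/-- `D` is the Levi-Civita connection of `a`: it is torsion free and compatible with `a`. -/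
def IsLeviCivita (a : RiemannianMetricOn E M)
    (D : CovariantDerivative 𝓘(ℝ, E) E (TangentSpace 𝓘(ℝ, E) : M → Type _)) : Prop :=
  D.torsion = 0 ∧
    ∀ (x : M) (Y Z : (p : M) → TangentSpace 𝓘(ℝ, E) p), MDiffAt (T% Y) x → MDiffAt (T% Z) x →
      ∀ w : TangentSpace 𝓘(ℝ, E) x,
        mvfderiv 𝓘(ℝ, E) (fun p => a.inner p (Y p) (Z p)) x w =
          a.inner x (D Y x w) (Z x) + a.inner x (Y x) (D Z x w)

/-- The family `D` of affine connections, indexed by a reference vector field `V`, is the Chern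
connection of `F`. In classical notation `D V Y x w` is `∇^V_w Y` at `x`. At every point at which
`V` is smooth and does not vanish, `∇^V` is torsion free and almost compatible with `F`:
`w (g_V(Y,Z)) = g_V(∇^V_w Y, Z) + g_V(Y, ∇^V_w Z) + 2 C_V(∇^V_w V, Y, Z)`. -/
def IsChernConnection (F : (x : M) → TangentSpace 𝓘(ℝ, E) x → ℝ)
    (D : ((x : M) → TangentSpace 𝓘(ℝ, E) x) →
      CovariantDerivative 𝓘(ℝ, E) E (TangentSpace 𝓘(ℝ, E) : M → Type _)) : Prop :=
  ∀ (V : (p : M) → TangentSpace 𝓘(ℝ, E) p) (x : M), CMDiffAt ∞ (T% V) x → V x ≠ 0 →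
    (D V).torsion x = 0 ∧
    ∀ Y Z : (p : M) → TangentSpace 𝓘(ℝ, E) p, MDiffAt (T% Y) x → MDiffAt (T% Z) x →
      ∀ w : TangentSpace 𝓘(ℝ, E) x,
        mvfderiv 𝓘(ℝ, E) (fun p => fundamentalTensor (F p) (V p) (Y p) (Z p)) x w =
          fundamentalTensor (F x) (V x) (D V Y x w) (Z x)
            + fundamentalTensor (F x) (V x) (Y x) (D V Z x w)
            + 2 * cartanTensor (F x) (V x) (D V V x w) (Y x) (Z x)

/-- The Chern connection of `F` and the Levi-Civita connection of `a` coincide: for every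
reference vector field the Chern connection of `F` is the Levi-Civita connection of `a`. -/
def ChernEqLeviCivita (F : (x : M) → TangentSpace 𝓘(ℝ, E) x → ℝ)
    (a : RiemannianMetricOn E M) : Prop :=
  ∃ D : CovariantDerivative 𝓘(ℝ, E) E (TangentSpace 𝓘(ℝ, E) : M → Type _),
    IsLeviCivita a D ∧ IsChernConnection F (fun _ => D)

end Manifold

/-! ### Lie groups, closed subgroups and homogeneous manifolds -/

section Homogeneous

variable {EG : Type*} [NormedAddCommGroup EG] [NormedSpace ℝ EG]
  {G : Type*} [TopologicalSpace G] [ChartedSpace EG G] [Group G]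

/-- The Lie algebra of `G`, with the Lie bracket of left invariant vector fields. -/
abbrev LieAlg (EG : Type*) [NormedAddCommGroup EG] [NormedSpace ℝ EG]
    (G : Type*) [TopologicalSpace G] [ChartedSpace EG G] [Group G] : Type _ :=
  GroupLieAlgebra 𝓘(ℝ, EG) G

/-- The adjoint action of `g`: the differential at `1` of `x ↦ g x g⁻¹`. -/
def Ad (g : G) (v : LieAlg EG G) : LieAlg EG G :=
  mfderiv 𝓘(ℝ, EG) 𝓘(ℝ, EG) (fun x : G => g * x * g⁻¹) 1 v

/-- `v` is the velocity at time `0` of a smooth curve in `H` starting at `1`. -/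
def IsVelocityIn (H : Subgroup G) (v : LieAlg EG G) : Prop :=
  ∃ γ : ℝ → G, γ 0 = 1 ∧ (∀ t, γ t ∈ H) ∧ ContMDiffAt 𝓘(ℝ, ℝ) 𝓘(ℝ, EG) ∞ γ 0 ∧
    (mfderiv 𝓘(ℝ, ℝ) 𝓘(ℝ, EG) γ 0 (1 : ℝ) : EG) = v

theorem IsVelocityIn.zero (H : Subgroup G) : IsVelocityIn H (0 : LieAlg EG G) := by
  refine ⟨fun _ => 1, rfl, fun _ => H.one_mem, contMDiffAt_const, ?_⟩
  rw [mfderiv_const]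
  rfl

theorem IsVelocityIn.smul {H : Subgroup G} {v : LieAlg EG G} (c : ℝ) (hv : IsVelocityIn H v) :
    IsVelocityIn H (c • v) := by
  obtain ⟨γ, h0, hH, hs, hd⟩ := hv
  have hm : ContMDiff 𝓘(ℝ, ℝ) 𝓘(ℝ, ℝ) ∞ (fun t : ℝ => c * t) := by
    rw [contMDiff_iff_contDiff]
    fun_prop
  have hs' : ContMDiffAt 𝓘(ℝ, ℝ) 𝓘(ℝ, EG) ∞ γ (c * 0) := by rwa [mul_zero]
  refine ⟨fun t => γ (c * t), by simpa using h0, fun t => hH _, ?_, ?_⟩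
  · exact hs'.comp (0 : ℝ) (f := fun t : ℝ => c * t) hm.contMDiffAt
  · have h1 := mfderiv_comp_apply (I := 𝓘(ℝ, ℝ)) (I' := 𝓘(ℝ, ℝ)) (I'' := 𝓘(ℝ, EG)) (0 : ℝ)
      (f := fun t : ℝ => c * t) (g := γ) (hs'.mdifferentiableAt (by simp))
      (hm.contMDiffAt.mdifferentiableAt (by simp)) (1 : ℝ)
    have h2 : (mfderiv 𝓘(ℝ, ℝ) 𝓘(ℝ, ℝ) (fun t : ℝ => c * t) 0 (1 : ℝ) : ℝ) = c • (1 : ℝ) := by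
      rw [mfderiv_eq_fderiv]
      have h3 := ((hasDerivAt_id (0 : ℝ)).const_mul c).hasFDerivAt.fderiv
      simp only [id] at h3
      have h4 := congrArg (fun L : ℝ →L[ℝ] ℝ => L 1) h3
      exact h4.trans (by simp)
    refine h1.trans ?_
    refine (congrArg (fun z : ℝ => (mfderiv 𝓘(ℝ, ℝ) 𝓘(ℝ, EG) γ (c * 0) z : EG)) h2).trans ?_
    rw [← hd]
    have key : ∀ z : ℝ, z = 0 → (mfderiv 𝓘(ℝ, ℝ) 𝓘(ℝ, EG) γ z (c • (1 : ℝ)) : EG) =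
        c • (mfderiv 𝓘(ℝ, ℝ) 𝓘(ℝ, EG) γ 0 (1 : ℝ) : EG) := by
      rintro z rfl
      exact ContinuousLinearMap.map_smul (mfderiv 𝓘(ℝ, ℝ) 𝓘(ℝ, EG) γ 0) c (1 : ℝ)
    exact key _ (mul_zero c)

theorem IsVelocityIn.add [LieGroup 𝓘(ℝ, EG) ∞ G] {H : Subgroup G} {v w : LieAlg EG G}
    (hv : IsVelocityIn H v) (hw : IsVelocityIn H w) : IsVelocityIn H (v + w) := by
  obtain ⟨γ, h0, hH, hs, hd⟩ := hv
  obtain ⟨δ, k0, kH, ks, kd⟩ := hw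
  refine ⟨fun t => γ t * δ t, by simp [h0, k0], fun t => H.mul_mem (hH t) (kH t), hs.mul ks, ?_⟩
  have hγ := hs.mdifferentiableAt (n := ∞) (by simp)
  have hδ := ks.mdifferentiableAt (n := ∞) (by simp)
  have hmul : MDifferentiableAt (𝓘(ℝ, EG).prod 𝓘(ℝ, EG)) 𝓘(ℝ, EG)
      (fun p : G × G => p.1 * p.2) (γ 0, δ 0) :=
    (contMDiff_mul 𝓘(ℝ, EG) ∞).mdifferentiableAt (by simp)
  have h1 := mfderiv_comp_apply (I := 𝓘(ℝ, ℝ)) (I' := 𝓘(ℝ, EG).prod 𝓘(ℝ, EG))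
    (I'' := 𝓘(ℝ, EG)) (0 : ℝ) (f := fun t : ℝ => (γ t, δ t))
    (g := fun p : G × G => p.1 * p.2) hmul (hγ.prodMk hδ) (1 : ℝ)
  refine h1.trans ?_
  rw [mfderiv_prod_eq_add_apply hmul, mfderiv_prodMk hγ hδ, ← hd, ← kd]
  have e1 : (fun z : G => z * δ 0) = id := by funext z; simp [k0]
  have e2 : (fun z : G => γ 0 * z) = id := by funext z; simp [h0]
  have key : ∀ f : G → G, f = id → ∀ (p : G) (z : EG),
      (mfderiv 𝓘(ℝ, EG) 𝓘(ℝ, EG) f p z : EG) = z := by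
    rintro f rfl p z
    rw [mfderiv_id]
    rfl
  exact congrArg₂ (fun p q : EG => p + q) (key _ e1 _ _) (key _ e2 _ _)

/-- The Lie algebra `𝔥` of the closed subgroup `H`: its tangent space at the identity. -/
def subgroupLieAlg [LieGroup 𝓘(ℝ, EG) ∞ G] (H : Subgroup G) : Submodule ℝ (LieAlg EG G) where
  carrier := {v | IsVelocityIn H v}
  zero_mem' := IsVelocityIn.zero H
  add_mem' := IsVelocityIn.add
  smul_mem' := fun c _ hv => hv.smul c

/-- `𝔤 = 𝔥 ⊕ 𝔪` is an `Ad(H)`-invariant decomposition. -/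
structure IsReductiveDecomposition [LieGroup 𝓘(ℝ, EG) ∞ G] (H : Subgroup G)
    (𝔪 : Submodule ℝ (LieAlg EG G)) : Prop where
  isCompl : IsCompl 𝔪 (subgroupLieAlg H)
  ad_mem : ∀ h ∈ H, ∀ v ∈ 𝔪, Ad h v ∈ 𝔪

/-- The `𝔪`-component `[x, y]_𝔪` of the Lie bracket with respect to `𝔤 = 𝔥 ⊕ 𝔪`. -/
def bracketM [LieGroup 𝓘(ℝ, EG) ∞ G] {H : Subgroup G} {𝔪 : Submodule ℝ (LieAlg EG G)}
    (h𝔪 : IsReductiveDecomposition H 𝔪) (x y : LieAlg EG G) : LieAlg EG G :=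
  𝔪.projection (subgroupLieAlg H) h𝔪.isCompl ⁅x, y⁆

variable {EM : Type*} [NormedAddCommGroup EM] [NormedSpace ℝ EM]
  {H : Subgroup G} [ChartedSpace EM (G ⧸ H)]

/-- The manifold structure on the coset space `G ⧸ H` is the canonical one: the unique one for
which the projection `G → G ⧸ H` is a smooth submersion. -/
structure IsHomogeneousManifold (EG EM : Type*) [NormedAddCommGroup EG] [NormedSpace ℝ EG]
    [NormedAddCommGroup EM] [NormedSpace ℝ EM] {G : Type*} [TopologicalSpace G]
    [ChartedSpace EG G] [Group G] (H : Subgroup G) [ChartedSpace EM (G ⧸ H)] : Prop where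
  smooth : ContMDiff 𝓘(ℝ, EG) 𝓘(ℝ, EM) ∞ (fun g : G => (g : G ⧸ H))
  submersion : ∀ g : G,
    Function.Surjective (mfderiv 𝓘(ℝ, EG) 𝓘(ℝ, EM) (fun g : G => (g : G ⧸ H)) g)

/-- The origin `o = eH` of `G ⧸ H`. -/
abbrev origin (H : Subgroup G) : G ⧸ H := ((1 : G) : G ⧸ H)

/-- The differential at the identity of the projection `G → G ⧸ H`; it restricts to the usual
identification of `𝔪` with the tangent space of `G ⧸ H` at the origin. -/
def toTangent (EM : Type*) [NormedAddCommGroup EM] [NormedSpace ℝ EM] (H : Subgroup G)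
    [ChartedSpace EM (G ⧸ H)] (v : LieAlg EG G) : TangentSpace 𝓘(ℝ, EM) (origin H) :=
  mfderiv 𝓘(ℝ, EG) 𝓘(ℝ, EM) (fun g : G => (g : G ⧸ H)) 1 v

/-- `a` is invariant under the left action of `G` on `G ⧸ H`. -/
def IsInvariantMetric [IsManifold 𝓘(ℝ, EM) ∞ (G ⧸ H)]
    (a : RiemannianMetricOn EM (G ⧸ H)) : Prop :=
  ∀ (g : G) (x : G ⧸ H) (u v : TangentSpace 𝓘(ℝ, EM) x),
    a.inner (g • x) (mfderiv 𝓘(ℝ, EM) 𝓘(ℝ, EM) (fun p : G ⧸ H => g • p) x u)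
      (mfderiv 𝓘(ℝ, EM) 𝓘(ℝ, EM) (fun p : G ⧸ H => g • p) x v) = a.inner x u v

/-- `X` is invariant under the left action of `G` on `G ⧸ H`. -/
def IsInvariantField (X : (x : G ⧸ H) → TangentSpace 𝓘(ℝ, EM) x) : Prop :=
  ∀ (g : G) (x : G ⧸ H),
    mfderiv 𝓘(ℝ, EM) 𝓘(ℝ, EM) (fun p : G ⧸ H => g • p) x (X x) = X (g • x)

variable [LieGroup 𝓘(ℝ, EG) ∞ G]

/-- The decomposition `𝔤 = 𝔥 ⊕ 𝔪` exhibits `(G ⧸ H, a)` as naturally reductive: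
`⟨[x,y]_𝔪, z⟩ + ⟨y, [x,z]_𝔪⟩ = 0` for `x, y, z ∈ 𝔪`, where `⟨ , ⟩` is induced by `a`. -/
def IsRiemannNaturallyReductiveWith [IsManifold 𝓘(ℝ, EM) ∞ (G ⧸ H)]
    (a : RiemannianMetricOn EM (G ⧸ H)) {𝔪 : Submodule ℝ (LieAlg EG G)}
    (h𝔪 : IsReductiveDecomposition H 𝔪) : Prop :=
  ∀ x ∈ 𝔪, ∀ y ∈ 𝔪, ∀ z ∈ 𝔪,
    a.inner (origin H) (toTangent EM H (bracketM h𝔪 x y)) (toTangent EM H z)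
      + a.inner (origin H) (toTangent EM H y) (toTangent EM H (bracketM h𝔪 x z)) = 0

variable (EG) in
/-- `(G ⧸ H, a)` is naturally reductive. -/
def IsRiemannNaturallyReductive [IsManifold 𝓘(ℝ, EM) ∞ (G ⧸ H)]
    (a : RiemannianMetricOn EM (G ⧸ H)) : Prop :=
  ∃ (𝔪 : Submodule ℝ (LieAlg EG G)) (h𝔪 : IsReductiveDecomposition H 𝔪),
    IsRiemannNaturallyReductiveWith a h𝔪

variable (EG) in
/-- `(G ⧸ H, F)` is naturally reductive in the sense of Latifi: for some `Ad(H)`-invariant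
decomposition `𝔤 = 𝔥 ⊕ 𝔪`, and with the tensors `g_y`, `C_y` on `𝔪` of the function
that `F` induces,
`g_y([x,u]_𝔪, v) + g_y(u, [x,v]_𝔪) + 2 C_y([x,y]_𝔪, u, v) = 0`
for all `x, y, u, v ∈ 𝔪` with `y ≠ 0`. -/
def IsLatifiNaturallyReductive
    (F : (x : G ⧸ H) → TangentSpace 𝓘(ℝ, EM) x → ℝ) : Prop :=
  ∃ (𝔪 : Submodule ℝ (LieAlg EG G)) (h𝔪 : IsReductiveDecomposition H 𝔪),
    ∀ y ∈ 𝔪, y ≠ 0 → ∀ x ∈ 𝔪, ∀ u ∈ 𝔪, ∀ v ∈ 𝔪,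
      fundamentalTensor (fun w => F (origin H) (toTangent EM H w)) y (bracketM h𝔪 x u) v
        + fundamentalTensor (fun w => F (origin H) (toTangent EM H w)) y u (bracketM h𝔪 x v)
        + 2 * cartanTensor (fun w => F (origin H) (toTangent EM H w)) y (bracketM h𝔪 x y) u v
        = 0

end Homogeneous

end HomogeneousFinsler

end

/-! Write `F² = Φ(p, q)` with `p = ã(y, y)`, `q = ã(X, y)`, and let `s = q/√p`. Then `∂Φ/∂p = φ(φ -
sφ')`, which is always positive, and `∂Φ/∂q = 2√p φφ'`, which is nonzero wherever `φ'` is.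

The connection hypothesis forces `X` to be parallel at the origin (`covariantDerivative_eq_zero`).
The Chern condition applied to `(V, V)` and the chain rule for `Φ(ã(V,V), ã(X,V))` compute the same
derivative, and they differ by `∂Φ/∂q · ã(∇_w X, V)`. Choosing `V = ∇_w X` at the point gives `∇_w X
= 0`.

Hence the form `ω = ã(X, ·)` is closed at `o`. Its pullback to `G` is left invariant, so Cartan's
formula for `dω` leaves only `ω([y, z]) = 0`, for all `y, z ∈ 𝔤` (`dualForm_bracket_eq_zero`). As
`𝔥` projects to zero, `ω([y, z]_𝔪) = 0`, which is the last claim.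

For the equivalence the decomposition is kept fixed. If `A = [x, ·]_𝔪` is skew for `ã`, then `p` and
`q` are both stationary along `A`, so `d(F²)_w(Aw) = 0` identically, and two differentiations give
Latifi's identity. Conversely, Latifi's identity at `u = v = y` reads `d(F²)_y([x, y]_𝔪) = 0`. The
`ω` term vanishes and `∂Φ/∂p > 0`, so `ã(y, [x, y]_𝔪) = 0`; polarization gives (1). -/

namespace HomogeneousFinsler

/-! ### Fundamental and Cartan tensors as Fréchet derivatives; Euler relations. -/

section Calculus

open Filter Topology

variable {V W : Type*} [NormedAddCommGroup V] [NormedSpace ℝ V]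
  [NormedAddCommGroup W] [NormedSpace ℝ W]

theorem deriv_comp_line {f : V → W} {y : V} (hf : DifferentiableAt ℝ f y) (v : V) :
    deriv (fun t : ℝ => f (y + t • v)) 0 = fderiv ℝ f y v :=
  hf.lineDeriv_eq_fderiv

theorem deriv_comp_line_apply {f : V → V →L[ℝ] W} {y : V} (hf : DifferentiableAt ℝ f y)
    (v w : V) : deriv (fun t : ℝ => f (y + t • v) w) 0 = fderiv ℝ f y v w := by
  rw [deriv_comp_line (f := fun x => f x w) (hf.clm_apply (differentiableAt_const w)) v,
    fderiv_clm_apply hf (differentiableAt_const w)]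
  simp

theorem tendsto_line (y v : V) : Tendsto (fun t : ℝ => y + t • v) (𝓝 0) (𝓝 y) := by
  have : Continuous fun t : ℝ => y + t • v := by fun_prop
  simpa using this.tendsto 0

/-- Passing from iterated one-variable derivatives to Fréchet derivatives makes the symmetry of
higher derivatives available. -/
theorem fundamentalTensor_eq {F : V → ℝ} {y : V} (hf : ContDiffAt ℝ 3 (fun w => F w ^ 2) y)
    (u v : V) : fundamentalTensor F y u v =
      1 / 2 * fderiv ℝ (fderiv ℝ fun w => F w ^ 2) y u v := by
  have h1 := hf.fderiv_right (m := 2) (by norm_num)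
  rw [fundamentalTensor, ← deriv_comp_line_apply (h1.differentiableAt (by simp))]
  congr 1
  apply EventuallyEq.deriv_eq
  filter_upwards [(tendsto_line y u).eventually (hf.eventually (by simp))] with s hs
  exact deriv_comp_line (f := fun w => F w ^ 2) (hs.differentiableAt (by simp)) v

theorem cartanTensor_eq {F : V → ℝ} {y : V} (hf : ContDiffAt ℝ 3 (fun w => F w ^ 2) y)
    (z u v : V) : cartanTensor F y z u v =
      1 / 4 * fderiv ℝ (fderiv ℝ (fderiv ℝ fun w => F w ^ 2)) y z u v := by
  have h1 := hf.fderiv_right (m := 2) (by norm_num)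
  have h2 := h1.fderiv_right (m := 1) (by norm_num)
  have h3 : DifferentiableAt ℝ (fun w => fderiv ℝ (fderiv ℝ fun w => F w ^ 2) w u) y :=
    (h2.differentiableAt (by simp)).clm_apply (differentiableAt_const u)
  have h4 := deriv_comp_line_apply h3 z v
  rw [fderiv_clm_apply (h2.differentiableAt (by simp)) (differentiableAt_const u)] at h4
  simp only [fderiv_fun_const, Pi.zero_apply, ContinuousLinearMap.comp_zero, zero_add,
    ContinuousLinearMap.flip_apply] at h4
  rw [cartanTensor, ← h4]
  congr 1
  apply EventuallyEq.deriv_eq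
  filter_upwards [(tendsto_line y z).eventually (hf.eventually (by simp))] with s hs
  have := fundamentalTensor_eq hs u v
  rw [fundamentalTensor] at this
  linarith

theorem fderiv_fderiv_comm {f : V → ℝ} {y : V} (hf : ContDiffAt ℝ 3 f y) (u v : V) :
    fderiv ℝ (fderiv ℝ f) y u v = fderiv ℝ (fderiv ℝ f) y v u :=
  ((hf.of_le (m := 2) (by norm_num)).isSymmSndFDerivAt (by simp)).eq u v

/-- Differentiating twice the invariance `f'(w)(A w) = 0` of `f = F²` under the flow of `A`. -/
theorem fundamentalTensor_add_add_cartanTensor_eq_zero {F : V → ℝ} {y : V}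
    (hf : ContDiffAt ℝ 3 (fun w => F w ^ 2) y) (A : V →L[ℝ] V)
    (hA : ∀ᶠ w in 𝓝 y, fderiv ℝ (fun w => F w ^ 2) w (A w) = 0) (u v : V) :
    fundamentalTensor F y (A u) v + fundamentalTensor F y u (A v)
      + 2 * cartanTensor F y (A y) u v = 0 := by
  rw [fundamentalTensor_eq hf, fundamentalTensor_eq hf, cartanTensor_eq hf]
  set f : V → ℝ := fun w => F w ^ 2
  have hf1 := hf.fderiv_right (m := 2) (by norm_num)
  have hf2 := hf1.fderiv_right (m := 1) (by norm_num)
  -- First differentiation, in the direction `v`. It holds near `y`, so it can be differentiated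
  -- again, in the direction `u`.
  have step : ∀ᶠ w in 𝓝 y, fderiv ℝ (fderiv ℝ f) w (A w) v + fderiv ℝ f w (A v) = 0 := by
    filter_upwards [hA.eventually_nhds, hf.eventually (by simp)] with w hw hfw
    have h1 := (hfw.fderiv_right (m := 2) (by norm_num)).differentiableAt (by simp)
    have h2 : fderiv ℝ (fun w => fderiv ℝ f w (A w)) w v = 0 := by
      rw [EventuallyEq.fderiv_eq (f₁ := fun w => fderiv ℝ f w (A w)) (f := fun _ => 0) hw]
      simp
    rw [fderiv_clm_apply h1 A.differentiableAt, A.fderiv] at h2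
    simp only [add_apply, ContinuousLinearMap.comp_apply,
      ContinuousLinearMap.flip_apply] at h2
    rw [fderiv_fderiv_comm hfw]
    linarith
  have h1 := hf1.differentiableAt (by simp)
  have h2 := hf2.differentiableAt (by simp)
  have h3 : DifferentiableAt ℝ (fun w => fderiv ℝ (fderiv ℝ f) w (A w)) y :=
    h2.clm_apply A.differentiableAt
  have h4 : fderiv ℝ (fun w => fderiv ℝ (fderiv ℝ f) w (A w) v + fderiv ℝ f w (A v)) y u = 0 := by
    rw [EventuallyEq.fderiv_eq (f := fun _ => (0 : ℝ)) step]
    simp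
  rw [fderiv_fun_add (h3.clm_apply (differentiableAt_const v))
    (h1.clm_apply (differentiableAt_const _)), fderiv_clm_apply h3 (differentiableAt_const v),
    fderiv_clm_apply h1 (differentiableAt_const _), fderiv_clm_apply h2 A.differentiableAt,
    A.fderiv] at h4
  simp only [add_apply, ContinuousLinearMap.comp_apply, fderiv_fun_const,
    Pi.zero_apply, ContinuousLinearMap.comp_zero, zero_add,
    ContinuousLinearMap.flip_apply] at h4
  have h5 : fderiv ℝ (fderiv ℝ (fderiv ℝ f)) y u (A y) =
      fderiv ℝ (fderiv ℝ (fderiv ℝ f)) y (A y) u :=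
    (hf1.isSymmSndFDerivAt (by simp)).eq u (A y)
  rw [h5] at h4
  linarith

/-- Euler's relations for the fundamental tensor of a positively homogeneous function. -/
theorem fundamentalTensor_apply_self {F : V → ℝ} {y : V}
    (hf : ContDiffAt ℝ 3 (fun w => F w ^ 2) y)
    (hom : ∀ᶠ w in 𝓝 y, fderiv ℝ (fun w => F w ^ 2) w w = 2 * F w ^ 2) (u : V) :
    fundamentalTensor F y u y = 1 / 2 * fderiv ℝ (fun w => F w ^ 2) y u := by
  rw [fundamentalTensor_eq hf]
  set f : V → ℝ := fun w => F w ^ 2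
  have h1 := (hf.fderiv_right (m := 2) (by norm_num)).differentiableAt (by simp)
  have h2 : fderiv ℝ (fun w => fderiv ℝ f w w) y u = fderiv ℝ (fun w => 2 * f w) y u := by
    rw [EventuallyEq.fderiv_eq (f₁ := fun w => fderiv ℝ f w w) (f := fun w => 2 * f w) hom]
  rw [fderiv_clm_apply h1 differentiableAt_fun_id,
    fderiv_const_mul (hf.differentiableAt (by simp))] at h2
  simp only [add_apply, ContinuousLinearMap.comp_apply, fderiv_fun_id,
    ContinuousLinearMap.id_apply, smul_apply, smul_eq_mul,
    ContinuousLinearMap.flip_apply] at h2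
  linarith

theorem fundamentalTensor_self {F : V → ℝ} {y : V}
    (hf : ContDiffAt ℝ 3 (fun w => F w ^ 2) y)
    (hom : ∀ᶠ w in 𝓝 y, fderiv ℝ (fun w => F w ^ 2) w w = 2 * F w ^ 2) :
    fundamentalTensor F y y y = F y ^ 2 := by
  rw [fundamentalTensor_apply_self hf hom, hom.self_of_nhds]
  ring

theorem fundamentalTensor_comm {F : V → ℝ} {y : V}
    (hf : ContDiffAt ℝ 3 (fun w => F w ^ 2) y) (u v : V) :
    fundamentalTensor F y u v = fundamentalTensor F y v u := by
  rw [fundamentalTensor_eq hf, fundamentalTensor_eq hf, fderiv_fderiv_comm hf]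

/-- Euler's relation `f''(w)(u, w) = f'(w)u` for `f = F²` is differentiated along `z`: the two
second-order terms cancel by symmetry and leave `f'''(z, u, y) = 0`. -/
theorem cartanTensor_apply_self {F : V → ℝ} {y : V}
    (hf : ContDiffAt ℝ 3 (fun w => F w ^ 2) y)
    (hom : ∀ᶠ w in 𝓝 y, fderiv ℝ (fun w => F w ^ 2) w w = 2 * F w ^ 2) (z u : V) :
    cartanTensor F y z u y = 0 := by
  rw [cartanTensor_eq hf]
  set f : V → ℝ := fun w => F w ^ 2
  have hf1 := hf.fderiv_right (m := 2) (by norm_num)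
  have h1 := hf1.differentiableAt (by simp)
  have h2 := (hf1.fderiv_right (m := 1) (by norm_num)).differentiableAt (by simp)
  have step : (fun w => fderiv ℝ (fderiv ℝ f) w u w) =ᶠ[𝓝 y] fun w => fderiv ℝ f w u := by
    filter_upwards [hf.eventually (by simp), hom.eventually_nhds] with w hfw hw
    have h3 := fundamentalTensor_apply_self hfw hw u
    rw [fundamentalTensor_eq hfw] at h3
    simp only [f]
    linarith
  have h3 : DifferentiableAt ℝ (fun w => fderiv ℝ (fderiv ℝ f) w u) y :=
    h2.clm_apply (differentiableAt_const u)
  have h4 := congrArg (fun L : V →L[ℝ] ℝ => L z) step.fderiv_eq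
  rw [fderiv_clm_apply h3 differentiableAt_fun_id, fderiv_clm_apply h2 (differentiableAt_const u),
    fderiv_clm_apply h1 (differentiableAt_const u)] at h4
  simp only [add_apply, ContinuousLinearMap.comp_apply, fderiv_fun_id,
    ContinuousLinearMap.id_apply, fderiv_fun_const, Pi.zero_apply, ContinuousLinearMap.comp_zero,
    zero_add, ContinuousLinearMap.flip_apply] at h4
  rw [fderiv_fderiv_comm hf u z] at h4
  linarith

end Calculus

/-! ### The two-variable profile of an `(α,β)`-metric. -/

section AlphaBeta

open Filter Topology

/-- The function `√(p) φ(q / √p)`, whose values at `p = ⟨y, y⟩`, `q = ⟨X, y⟩` define an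
`(α,β)`-metric. -/
noncomputable def alphaBetaProfile (φ : ℝ → ℝ) (p q : ℝ) : ℝ := √p * φ (q / √p)

variable {φ : ℝ → ℝ} {b₀ : ℝ}

theorem IsAlphaBetaFunction.contDiffAt (hφ : IsAlphaBetaFunction φ b₀) {s : ℝ} (hs : |s| < b₀) :
    ContDiffAt ℝ ∞ φ s :=
  hφ.smooth.contDiffAt (Ioo_mem_nhds (abs_lt.1 hs).1 (abs_lt.1 hs).2)

/-- The choice `b = |s|` in the convexity condition removes the `φ''` term. -/
theorem IsAlphaBetaFunction.sub_mul_deriv_pos (hφ : IsAlphaBetaFunction φ b₀) {s : ℝ}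
    (hs : |s| < b₀) : 0 < φ s - s * deriv φ s := by
  have := hφ.convex s |s| le_rfl hs
  rwa [sq_abs, sub_self, zero_mul, add_zero] at this

theorem contDiffAt_alphaBetaProfile_sq (hφ : IsAlphaBetaFunction φ b₀) {p q : ℝ} (hp : 0 < p)
    (hq : |q / √p| < b₀) :
    ContDiffAt ℝ ∞ (fun z : ℝ × ℝ => alphaBetaProfile φ z.1 z.2 ^ 2) (p, q) := by
  have h1 : ContDiffAt ℝ ∞ (fun z : ℝ × ℝ => √z.1) (p, q) := contDiffAt_fst.sqrt hp.ne'
  have h2 : ContDiffAt ℝ ∞ (fun z : ℝ × ℝ => z.2 / √z.1) (p, q) :=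
    contDiffAt_snd.div h1 (Real.sqrt_pos.2 hp).ne'
  have h3 : ContDiffAt ℝ ∞ (fun z : ℝ × ℝ => φ (z.2 / √z.1)) (p, q) :=
    ContDiffAt.comp (p, q) (g := φ) (hφ.contDiffAt hq) h2
  exact (h1.mul h3).pow 2

/-- The function is `p φ(s)²` with `s = q/√p`, `∂s/∂p = -s/(2p)` and `∂s/∂q = 1/√p`. The sign of the
first coefficient and the non-vanishing of the second drive the whole proof. -/
theorem hasFDerivAt_alphaBetaProfile_sq (hφ : IsAlphaBetaFunction φ b₀) {p q : ℝ} (hp : 0 < p)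
    (hq : |q / √p| < b₀) :
    HasFDerivAt (fun z : ℝ × ℝ => alphaBetaProfile φ z.1 z.2 ^ 2)
      ((φ (q / √p) * (φ (q / √p) - q / √p * deriv φ (q / √p))) • ContinuousLinearMap.fst ℝ ℝ ℝ
        + (2 * √p * φ (q / √p) * deriv φ (q / √p)) • ContinuousLinearMap.snd ℝ ℝ ℝ) (p, q) := by
  have hs : 0 < √p := Real.sqrt_pos.2 hp
  have h1 : HasFDerivAt (fun z : ℝ × ℝ => √z.1) _ (p, q) := hasFDerivAt_fst.sqrt hp.ne'
  have h0 : HasFDerivAt (fun z : ℝ × ℝ => z.2) (ContinuousLinearMap.snd ℝ ℝ ℝ) (p, q) :=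
    hasFDerivAt_snd
  have hi : HasFDerivAt (fun z : ℝ × ℝ => (√z.1)⁻¹) _ (p, q) :=
    HasDerivAt.comp_hasFDerivAt (p, q) (h₂ := fun t : ℝ => t⁻¹) (hasDerivAt_inv hs.ne') h1
  have h2 : HasFDerivAt (fun z : ℝ × ℝ => z.2 / √z.1) _ (p, q) := h0.mul hi
  have h3 : HasFDerivAt (fun z : ℝ × ℝ => φ (z.2 / √z.1)) _ (p, q) :=
    HasDerivAt.comp_hasFDerivAt (p, q) (h₂ := φ)
      ((hφ.contDiffAt hq).differentiableAt (by simp)).hasDerivAt h2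
  refine ((h1.mul h3).pow 2).congr_fderiv ?_
  have h5 : √p ^ 2 = p := Real.sq_sqrt hp.le
  ext <;> simp <;> field_simp <;> ring

end AlphaBeta

/-! ### `(α,β)`-norms on a vector space with a symmetric bilinear form. -/

section AlphaBetaNorm

open Filter Topology

variable {V : Type*} [NormedAddCommGroup V] [NormedSpace ℝ V]

/-- The function `y ↦ α φ(β / α)`, `α = √(B y y)`, `β = ℓ y`, on a vector space. -/
noncomputable def alphaBetaNorm (φ : ℝ → ℝ) (B : V →L[ℝ] V →L[ℝ] ℝ) (ℓ : V →L[ℝ] ℝ) (y : V) : ℝ :=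
  alphaBetaProfile φ (B y y) (ℓ y)

/-- The linear form `ℓ` has norm less than `b₀` with respect to the semi-inner product `B`. -/
structure IsAlphaBetaPair (B : V →L[ℝ] V →L[ℝ] ℝ) (ℓ : V →L[ℝ] ℝ) (b₀ : ℝ) : Prop where
  symm : ∀ u v, B u v = B v u
  bound : ∀ y, 0 < B y y → |ℓ y / √(B y y)| < b₀

variable {φ : ℝ → ℝ} {b₀ : ℝ} {B : V →L[ℝ] V →L[ℝ] ℝ} {ℓ : V →L[ℝ] ℝ}

theorem contDiff_apply_self (B : V →L[ℝ] V →L[ℝ] ℝ) : ContDiff ℝ ∞ fun y => B y y :=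
  B.contDiff.clm_apply contDiff_id

theorem IsAlphaBetaPair.contDiffAt_sq (hφ : IsAlphaBetaFunction φ b₀) (h : IsAlphaBetaPair B ℓ b₀)
    {y : V} (hy : 0 < B y y) : ContDiffAt ℝ 3 (fun w => alphaBetaNorm φ B ℓ w ^ 2) y :=
  (ContDiffAt.comp (n := ∞) y (f := fun w => (B w w, ℓ w))
    (contDiffAt_alphaBetaProfile_sq hφ hy (h.bound y hy))
    ((contDiff_apply_self B).contDiffAt.prodMk ℓ.contDiff.contDiffAt)).of_le
      ENat.LEInfty.out

theorem IsAlphaBetaPair.fderiv_sq (hφ : IsAlphaBetaFunction φ b₀) (h : IsAlphaBetaPair B ℓ b₀)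
    {y : V} (hy : 0 < B y y) (w : V) :
    fderiv ℝ (fun w => alphaBetaNorm φ B ℓ w ^ 2) y w =
      2 * (φ (ℓ y / √(B y y)) *
        (φ (ℓ y / √(B y y)) - ℓ y / √(B y y) * deriv φ (ℓ y / √(B y y)))) * B y w
        + 2 * √(B y y) * φ (ℓ y / √(B y y)) * deriv φ (ℓ y / √(B y y)) * ℓ w := by
  have h1 : HasFDerivAt (fun w => B w w) _ y :=
    (B.hasFDerivAt (x := y)).clm_apply (hasFDerivAt_id y)
  have h2 := (hasFDerivAt_alphaBetaProfile_sq hφ hy (h.bound y hy)).comp y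
    (f := fun w => (B w w, ℓ w)) (h1.prodMk (ℓ.hasFDerivAt (x := y)))
  have h3 := congrArg (fun L : V →L[ℝ] ℝ => L w) h2.fderiv
  refine Eq.trans h3 ?_
  simp [h.symm w y]
  ring

theorem eventually_apply_self_pos {y : V} (hy : 0 < B y y) : ∀ᶠ w in 𝓝 y, 0 < B w w :=
  (contDiff_apply_self B).continuous.continuousAt.eventually (lt_mem_nhds hy)

theorem IsAlphaBetaPair.fderiv_sq_self (hφ : IsAlphaBetaFunction φ b₀)
    (h : IsAlphaBetaPair B ℓ b₀) {y : V} (hy : 0 < B y y) :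
    fderiv ℝ (fun w => alphaBetaNorm φ B ℓ w ^ 2) y y = 2 * alphaBetaNorm φ B ℓ y ^ 2 := by
  have hs : 0 < √(B y y) := Real.sqrt_pos.2 hy
  have h5 : √(B y y) ^ 2 = B y y := Real.sq_sqrt hy.le
  rw [h.fderiv_sq hφ hy, alphaBetaNorm, alphaBetaProfile, mul_pow, h5]
  generalize deriv φ (ℓ y / √(B y y)) = d
  generalize φ (ℓ y / √(B y y)) = e
  have h6 : ℓ y / √(B y y) * B y y = √(B y y) * ℓ y := by
    rw [div_mul_eq_mul_div, div_eq_iff hs.ne']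
    linear_combination (-ℓ y) * h5
  linear_combination (-2 * e * d) * h6

theorem IsAlphaBetaPair.eventually_fderiv_sq_self (hφ : IsAlphaBetaFunction φ b₀)
    (h : IsAlphaBetaPair B ℓ b₀) {y : V} (hy : 0 < B y y) :
    ∀ᶠ w in 𝓝 y,
      fderiv ℝ (fun w => alphaBetaNorm φ B ℓ w ^ 2) w w = 2 * alphaBetaNorm φ B ℓ w ^ 2 :=
  (eventually_apply_self_pos hy).mono fun _ hw => h.fderiv_sq_self hφ hw

theorem IsAlphaBetaPair.fundamentalTensor_self (hφ : IsAlphaBetaFunction φ b₀)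
    (h : IsAlphaBetaPair B ℓ b₀) {y : V} (hy : 0 < B y y) :
    fundamentalTensor (alphaBetaNorm φ B ℓ) y y y = alphaBetaNorm φ B ℓ y ^ 2 :=
  HomogeneousFinsler.fundamentalTensor_self (h.contDiffAt_sq hφ hy)
    (h.eventually_fderiv_sq_self hφ hy)

/-- The contraction of `g_y(·,·)` and `C_y` with `y` occurring in both connection conditions. -/
theorem IsAlphaBetaPair.fundamentalTensor_contraction (hφ : IsAlphaBetaFunction φ b₀)
    (h : IsAlphaBetaPair B ℓ b₀) {y : V} (hy : 0 < B y y) (w : V) :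
    fundamentalTensor (alphaBetaNorm φ B ℓ) y w y + fundamentalTensor (alphaBetaNorm φ B ℓ) y y w
        + 2 * cartanTensor (alphaBetaNorm φ B ℓ) y w y y =
      fderiv ℝ (fun w => alphaBetaNorm φ B ℓ w ^ 2) y w := by
  have h1 := h.contDiffAt_sq hφ hy
  have h2 := h.eventually_fderiv_sq_self hφ hy
  rw [fundamentalTensor_comm h1 y w, fundamentalTensor_apply_self h1 h2,
    cartanTensor_apply_self h1 h2]
  ring

/-- If `A` is infinitesimally isometric and annihilates the form `ℓ`, then `g_y` and `C_y` are
infinitesimally invariant under `A`. -/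
theorem IsAlphaBetaPair.tensor_invariance (hφ : IsAlphaBetaFunction φ b₀)
    (h : IsAlphaBetaPair B ℓ b₀) {y : V} (hy : 0 < B y y) (A : V →L[ℝ] V)
    (hA : ∀ w, B w (A w) = 0) (hℓ : ∀ w, ℓ (A w) = 0) (u v : V) :
    fundamentalTensor (alphaBetaNorm φ B ℓ) y (A u) v
      + fundamentalTensor (alphaBetaNorm φ B ℓ) y u (A v)
      + 2 * cartanTensor (alphaBetaNorm φ B ℓ) y (A y) u v = 0 := by
  refine fundamentalTensor_add_add_cartanTensor_eq_zero (h.contDiffAt_sq hφ hy) A ?_ u v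
  -- `F²` depends on `w` only through `B w w` and `ℓ w`, and both are stationary in the direction `A
  -- w`.
  filter_upwards [eventually_apply_self_pos hy] with w hw
  rw [h.fderiv_sq hφ hw, hA, hℓ]
  ring

/-- If `F²` has vanishing derivative at `y` in a direction annihilated by `ℓ`, then this direction
is orthogonal to `y`. -/
theorem IsAlphaBetaPair.apply_eq_zero_of_fderiv_sq (hφ : IsAlphaBetaFunction φ b₀)
    (h : IsAlphaBetaPair B ℓ b₀) {y : V} (hy : 0 < B y y) {w : V} (hℓ : ℓ w = 0)
    (hw : fderiv ℝ (fun w => alphaBetaNorm φ B ℓ w ^ 2) y w = 0) : B y w = 0 := by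
  have hb := h.bound y hy
  have h1 := hφ.pos _ (abs_lt.1 hb)
  have h2 := hφ.sub_mul_deriv_pos hb
  rw [h.fderiv_sq hφ hy, hℓ, mul_zero, add_zero] at hw
  exact (mul_eq_zero.1 hw).resolve_left (by positivity)

end AlphaBetaNorm

/-! ### Cauchy–Schwarz and the bound on `β/α`. -/

section Manifold

open Filter Topology

variable {E : Type*} [NormedAddCommGroup E] [NormedSpace ℝ E]
  {M : Type*} [TopologicalSpace M] [ChartedSpace E M] [IsManifold 𝓘(ℝ, E) ∞ M]
  {a : RiemannianMetricOn E M} {X : (x : M) → TangentSpace 𝓘(ℝ, E) x} {φ : ℝ → ℝ} {b₀ : ℝ}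

theorem RiemannianMetricOn.inner_self_nonneg (a : RiemannianMetricOn E M) (x : M)
    (y : TangentSpace 𝓘(ℝ, E) x) : 0 ≤ a.inner x y y := by
  by_cases hy : y = 0
  · simp [hy]
  · exact (a.pos x y hy).le

theorem RiemannianMetricOn.inner_sq_le (a : RiemannianMetricOn E M) (x : M)
    (y z : TangentSpace 𝓘(ℝ, E) x) : a.inner x y z ^ 2 ≤ a.inner x y y * a.inner x z z := by
  by_cases hy : z = 0
  · simp [hy]
  have h1 := a.pos x z hy
  -- Cauchy–Schwarz: this vector is `⟨z,z⟩` times the component of `y` orthogonal to `z`.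
  have h2 := a.inner_self_nonneg x (a.inner x z z • y - a.inner x y z • z)
  simp only [map_sub, map_smul, sub_apply, smul_apply, smul_eq_mul, a.symm x z y] at h2
  have h3 : 0 ≤ a.inner x z z * (a.inner x y y * a.inner x z z - a.inner x y z ^ 2) := by
    linarith
  linarith [nonneg_of_mul_nonneg_right h3 h1]

theorem abs_betaRatio_lt (hXb : ∀ x, √(a.inner x (X x) (X x)) < b₀) (x : M)
    (y : TangentSpace 𝓘(ℝ, E) x) (hy : 0 < a.inner x y y) : |betaRatio a X x y| < b₀ := by
  refine lt_of_le_of_lt ?_ (hXb x)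
  rw [betaRatio, abs_div, abs_of_nonneg (Real.sqrt_nonneg _), div_le_iff₀ (Real.sqrt_pos.2 hy),
    ← Real.sqrt_mul (a.inner_self_nonneg x _)]
  exact Real.abs_le_sqrt (a.inner_sq_le x _ _)

/-- The metric and the one-form of `(α,β)`-data at a point, on the model space. -/
theorem isAlphaBetaPair_inner (hXb : ∀ x, √(a.inner x (X x) (X x)) < b₀) (x : M) :
    IsAlphaBetaPair (V := E) (a.inner x) (a.inner x (X x)) b₀ :=
  ⟨a.symm x, abs_betaRatio_lt hXb x⟩

end Manifold

/-! ### The vector field `X` is parallel. -/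

section Parallel

open Filter Topology

variable {E : Type*} [NormedAddCommGroup E] [NormedSpace ℝ E]
  {M : Type*} [TopologicalSpace M] [ChartedSpace E M]

theorem HasFDerivAt.mvfderiv_comp_prodMk {Φ : ℝ × ℝ → ℝ} {u q : M → ℝ} {x : M}
    {L : ℝ × ℝ →L[ℝ] ℝ} (hΦ : HasFDerivAt Φ L (u x, q x))
    (hu : MDifferentiableAt 𝓘(ℝ, E) 𝓘(ℝ, ℝ) u x) (hq : MDifferentiableAt 𝓘(ℝ, E) 𝓘(ℝ, ℝ) q x)
    (w : TangentSpace 𝓘(ℝ, E) x) :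
    mvfderiv 𝓘(ℝ, E) (fun p => Φ (u p, q p)) x w =
      L (mvfderiv 𝓘(ℝ, E) u x w, mvfderiv 𝓘(ℝ, E) q x w) := by
  have h1 := hu.hasMFDerivAt
  have h2 := hq.hasMFDerivAt
  have h3 : HasMFDerivAt 𝓘(ℝ, E) 𝓘(ℝ, ℝ × ℝ) (fun p => (u p, q p)) x
      ((mvfderiv 𝓘(ℝ, E) u x).prod (mvfderiv 𝓘(ℝ, E) q x)) :=
    ⟨h1.1.prodMk h2.1, h1.2.prodMk h2.2⟩
  have h4 := (HasMFDerivAt.comp x hΦ.hasMFDerivAt h3).mfderiv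
  exact congrArg (fun A : E →L[ℝ] ℝ => A w) h4

theorem EventuallyEq.mvfderiv_eq {f g : M → ℝ} {x : M} (h : f =ᶠ[𝓝 x] g)
    (w : TangentSpace 𝓘(ℝ, E) x) : mvfderiv 𝓘(ℝ, E) f x w = mvfderiv 𝓘(ℝ, E) g x w :=
  congrArg (fun A : E →L[ℝ] ℝ => A w) (h.mfderiv_eq (I := 𝓘(ℝ, E)) (I' := 𝓘(ℝ, ℝ)))

variable [IsManifold 𝓘(ℝ, E) ∞ M]
  {a : RiemannianMetricOn E M} {X : (x : M) → TangentSpace 𝓘(ℝ, E) x} {φ : ℝ → ℝ} {b₀ : ℝ}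

theorem RiemannianMetricOn.mdifferentiableAt_inner (a : RiemannianMetricOn E M) {x : M}
    {Y Z : (p : M) → TangentSpace 𝓘(ℝ, E) p} (hY : MDiffAt (T% Y) x) (hZ : MDiffAt (T% Z) x) :
    MDifferentiableAt 𝓘(ℝ, E) 𝓘(ℝ, ℝ) (fun p => a.inner p (Y p) (Z p)) x := by
  have h : MDifferentiableAt 𝓘(ℝ, E) (𝓘(ℝ, E).prod 𝓘(ℝ, ℝ)) (fun p =>
      Bundle.TotalSpace.mk' ℝ (E := Bundle.Trivial M ℝ) p (a.inner p (Y p) (Z p))) x :=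
    MDifferentiableAt.clm_bundle_apply₂ (F₁ := E) (F₂ := E)
      (a.contMDiff.mdifferentiableAt (by simp)) hY hZ
  simp only [mdifferentiableAt_totalSpace] at h
  exact h.2

variable [FiniteDimensional ℝ E]

/-- `w(F²(V))` is computed twice. Almost compatibility with `Y = Z = V` and Euler's relations give
the fibre derivative of `F²` along `∇_w V`. The chain rule with metric compatibility gives the same
plus `2√p φφ' ã(∇_w X, V)`, so this extra term vanishes. -/
theorem covariantDerivative_eq_zero (hφ : IsAlphaBetaFunction φ b₀)
    (hXb : ∀ x, √(a.inner x (X x) (X x)) < b₀)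
    {D : CovariantDerivative 𝓘(ℝ, E) E (TangentSpace 𝓘(ℝ, E) : M → Type _)}
    (hLC : IsLeviCivita a D) (hC : IsChernConnection (alphaBetaMetric a X φ) fun _ => D)
    {x : M} (hX : MDiffAt (T% X) x)
    (hφ' : ∀ y : TangentSpace 𝓘(ℝ, E) x, y ≠ 0 → deriv φ (betaRatio a X x y) ≠ 0)
    (w : TangentSpace 𝓘(ℝ, E) x) : D X x w = 0 := by
  by_contra hne
  set v : TangentSpace 𝓘(ℝ, E) x := D X x w with hv
  -- The reference field takes the value `∇_w X` at `x`, so the surviving term becomes a multiple of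
  -- `ã(∇_w X, ∇_w X)`.
  set V : (p : M) → TangentSpace 𝓘(ℝ, E) p := FiberBundle.extend E v with hVdef
  have hVx : V x = v := FiberBundle.extend_apply_self E v
  have hVs : CMDiffAt ∞ (T% V) x := FiberBundle.contMDiffAt_extend 𝓘(ℝ, E) E v
  have hV : MDiffAt (T% V) x := hVs.mdifferentiableAt (by simp)
  have hpos : 0 < a.inner x (V x) (V x) := a.pos x _ (by rwa [hVx])
  have hpair := isAlphaBetaPair_inner hXb x
  have hu := a.mdifferentiableAt_inner hV hV
  have hq := a.mdifferentiableAt_inner hX hV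
  -- Where `V ≠ 0`, Euler's relation gives `g_V(V, V) = F²(V)`; this is needed near `x` because it
  -- gets differentiated.
  have hloc : (fun p => fundamentalTensor (alphaBetaMetric a X φ p) (V p) (V p) (V p)) =ᶠ[𝓝 x]
      fun p => alphaBetaProfile φ (a.inner p (V p) (V p)) (a.inner p (X p) (V p)) ^ 2 := by
    filter_upwards [hu.continuousAt.eventually (lt_mem_nhds hpos)] with p hp
    exact (isAlphaBetaPair_inner hXb p).fundamentalTensor_self hφ hp
  have h1 := (hC V x hVs (by rwa [hVx])).2 V V hV hV w
  have h2 := EventuallyEq.mvfderiv_eq hloc w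
  have h3 := HasFDerivAt.mvfderiv_comp_prodMk (u := fun p => a.inner p (V p) (V p))
    (q := fun p => a.inner p (X p) (V p)) (hasFDerivAt_alphaBetaProfile_sq hφ hpos (hpair.bound _ hpos)) hu hq w
  have h4 := hpair.fundamentalTensor_contraction hφ hpos (D V x w)
  have h5 := hpair.fderiv_sq hφ hpos (D V x w)
  have h6 := hLC.2 x V V hV hV w
  have h7 := hLC.2 x X V hX hV w
  have h8 : a.inner x (D V x w) (V x) = a.inner x (V x) (D V x w) := a.symm x _ _
  have h9 := h1.symm.trans (h2.trans h3)
  have h10 := (h4.trans h5).symm.trans h9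
  simp only [add_apply, smul_apply, ContinuousLinearMap.coe_fst', ContinuousLinearMap.coe_snd',
    smul_eq_mul] at h10
  rw [h6, h7, h8] at h10
  have hb := hpair.bound _ hpos
  have h11 := hφ.pos _ (abs_lt.1 hb)
  have h12 := hφ' (V x) (by rwa [hVx])
  have h13 : 0 < √(a.inner x (V x) (V x)) := Real.sqrt_pos.2 hpos
  -- All terms containing `∇_w V` cancel.
  have h14 : 2 * √(a.inner x (V x) (V x)) * φ (betaRatio a X x (V x)) *
      deriv φ (betaRatio a X x (V x)) * a.inner x (D X x w) (V x) = 0 := by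
    unfold betaRatio
    linear_combination -h10
  have h15 : a.inner x (D X x w) (V x) = 0 := by
    refine (mul_eq_zero.1 h14).resolve_left (mul_ne_zero ?_ h12)
    exact (mul_pos (mul_pos two_pos h13) h11).ne'
  rw [← hv, hVx] at h15
  exact (a.pos x v hne).ne' h15

end Parallel

/-! ### Closed one-forms and Lie brackets in coordinates. -/

section ClosedForm

open Filter Topology VectorField

/-- In a basis of the finite-dimensional domain, an operator is the finite tuple of its values. -/
theorem differentiableAt_clm_of_apply {D E F : Type*} [NormedAddCommGroup D] [NormedSpace ℝ D]
    [NormedAddCommGroup E] [NormedSpace ℝ E] [FiniteDimensional ℝ E]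
    [NormedAddCommGroup F] [NormedSpace ℝ F] {f : D → E →L[ℝ] F} {x : D}
    (h : ∀ y, DifferentiableAt ℝ (fun x => f x y) x) : DifferentiableAt ℝ f x := by
  let d := Module.finrank ℝ E
  have hd : d = Module.finrank ℝ (Fin d → ℝ) := (Module.finrank_fin_fun ℝ).symm
  let e₁ := ContinuousLinearEquiv.ofFinrankEq hd
  let e₂ := (e₁.arrowCongr (1 : F ≃L[ℝ] F)).trans (ContinuousLinearEquiv.piRing (Fin d))
  rw [← Function.id_comp f, ← e₂.symm_comp_self]
  exact e₂.symm.differentiableAt.comp x (differentiableAt_pi.mpr fun i => h _)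

variable {E E' : Type*} [NormedAddCommGroup E] [NormedSpace ℝ E]
  [NormedAddCommGroup E'] [NormedSpace ℝ E']

/-- A one-form with symmetric derivative at `p c`, whose pullback under `p` is constant on two
vector fields, annihilates the image of their Lie bracket. -/
theorem apply_fderiv_lieBracket_eq_zero {p : E → E'} {θ : E' → E' →L[ℝ] ℝ} {V W : E → E} {c : E}
    (hp : ContDiffAt ℝ 2 p c) (hθ : DifferentiableAt ℝ θ (p c))
    (hsymm : ∀ u v, fderiv ℝ θ (p c) u v = fderiv ℝ θ (p c) v u)
    (hV : DifferentiableAt ℝ V c) (hW : DifferentiableAt ℝ W c) {CV CW : ℝ}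
    (hθV : ∀ᶠ q in 𝓝 c, θ (p q) (fderiv ℝ p q (V q)) = CV)
    (hθW : ∀ᶠ q in 𝓝 c, θ (p q) (fderiv ℝ p q (W q)) = CW) :
    θ (p c) (fderiv ℝ p c (lieBracket ℝ V W c)) = 0 := by
  have hp1 : DifferentiableAt ℝ (fderiv ℝ p) c :=
    (hp.fderiv_right (m := 1) (by norm_num)).differentiableAt (by simp)
  have hp0 : DifferentiableAt ℝ p c := hp.differentiableAt (by simp)
  have hθp : DifferentiableAt ℝ (fun q => θ (p q)) c := hθ.comp c hp0
  -- Derivative of the constant `(p^*θ)(U)` along `w`, by the product rule.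
  have key : ∀ {U : E → E} {C : ℝ}, DifferentiableAt ℝ U c →
      (∀ᶠ q in 𝓝 c, θ (p q) (fderiv ℝ p q (U q)) = C) → ∀ w,
      fderiv ℝ θ (p c) (fderiv ℝ p c w) (fderiv ℝ p c (U c))
        + θ (p c) (fderiv ℝ (fderiv ℝ p) c w (U c)) + θ (p c) (fderiv ℝ p c (fderiv ℝ U c w))
        = 0 := by
    intro U C hU h w
    have h1 : fderiv ℝ (fun q => θ (p q) (fderiv ℝ p q (U q))) c w = 0 := by
      rw [EventuallyEq.fderiv_eq (f := fun _ => C) h]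
      simp
    rw [fderiv_clm_apply hθp (hp1.clm_apply hU), fderiv_clm_apply hp1 hU,
      fderiv_fun_comp c hθ hp0] at h1
    simp only [add_apply, ContinuousLinearMap.comp_apply, ContinuousLinearMap.flip_apply,
      map_add] at h1
    linarith
  -- On subtraction, the `θ'` terms cancel by closedness and the `p''` terms by symmetry; the
  -- remaining terms form the bracket.
  have h1 := key hV hθV (W c)
  have h2 := key hW hθW (V c)
  have h3 := hsymm (fderiv ℝ p c (W c)) (fderiv ℝ p c (V c))
  have h4 : fderiv ℝ (fderiv ℝ p) c (W c) (V c) = fderiv ℝ (fderiv ℝ p) c (V c) (W c) :=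
    (hp.isSymmSndFDerivAt (by simp)).eq _ _
  rw [lieBracket, map_sub, map_sub]
  rw [h4] at h1
  linarith

variable {M : Type*} [TopologicalSpace M] [ChartedSpace E M]

/-- The derivative of the inverse of the preferred chart at `x₀`, on the model space. -/
noncomputable def chartSymmDeriv (E : Type*) [NormedAddCommGroup E] [NormedSpace ℝ E]
    {M : Type*} [TopologicalSpace M] [ChartedSpace E M] (x₀ : M) (m : E) : E →L[ℝ] E :=
  mfderivWithin 𝓘(ℝ, E) 𝓘(ℝ, E) (extChartAt 𝓘(ℝ, E) x₀).symm (Set.range 𝓘(ℝ, E)) m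

/-- The derivative of the preferred chart at `x₀`, on the model space. -/
noncomputable def chartDeriv (E : Type*) [NormedAddCommGroup E] [NormedSpace ℝ E]
    {M : Type*} [TopologicalSpace M] [ChartedSpace E M] (x₀ p : M) : E →L[ℝ] E :=
  mfderiv 𝓘(ℝ, E) 𝓘(ℝ, E) (extChartAt 𝓘(ℝ, E) x₀) p

/-- The coordinate expression of a one-form in the preferred chart at `x₀`. -/
noncomputable def chartForm (α : M → E →L[ℝ] ℝ) (x₀ : M) (m : E) : E →L[ℝ] ℝ :=
  (α ((extChartAt 𝓘(ℝ, E) x₀).symm m)).comp (chartSymmDeriv E x₀ m)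

section Chart

variable [IsManifold 𝓘(ℝ, E) ∞ M]

theorem chartDeriv_chartSymmDeriv {x₀ : M} {m : E} (hm : m ∈ (extChartAt 𝓘(ℝ, E) x₀).target)
    (u : E) : chartDeriv E x₀ ((extChartAt 𝓘(ℝ, E) x₀).symm m) (chartSymmDeriv E x₀ m u) = u :=
  congrArg (fun L : E →L[ℝ] E => L u)
    (mfderiv_extChartAt_comp_mfderivWithin_extChartAt_symm (I := 𝓘(ℝ, E)) hm)

theorem chartSymmDeriv_chartDeriv {x₀ p : M} (hp : p ∈ (extChartAt 𝓘(ℝ, E) x₀).source)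
    (u : E) : chartSymmDeriv E x₀ (extChartAt 𝓘(ℝ, E) x₀ p) (chartDeriv E x₀ p u) = u :=
  congrArg (fun L : E →L[ℝ] E => L u)
    (mfderivWithin_extChartAt_symm_comp_mfderiv_extChartAt' (I := 𝓘(ℝ, E)) hp)

theorem chartDeriv_self (x₀ : M) : chartDeriv E x₀ x₀ = ContinuousLinearMap.id ℝ E :=
  mfderiv_extChartAt_self (I := 𝓘(ℝ, E))

theorem chartSymmDeriv_self (x₀ : M) :
    chartSymmDeriv E x₀ (extChartAt 𝓘(ℝ, E) x₀ x₀) = ContinuousLinearMap.id ℝ E :=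
  mfderivWithin_range_extChartAt_symm (I := 𝓘(ℝ, E))

theorem chartForm_apply_chartDeriv (α : M → E →L[ℝ] ℝ) {x₀ p : M}
    (hp : p ∈ (extChartAt 𝓘(ℝ, E) x₀).source) (u : E) :
    chartForm α x₀ (extChartAt 𝓘(ℝ, E) x₀ p) (chartDeriv E x₀ p u) = α p u := by
  rw [chartForm, ContinuousLinearMap.comp_apply, chartSymmDeriv_chartDeriv hp,
    (extChartAt 𝓘(ℝ, E) x₀).left_inv hp]

end Chart

/-- The coordinate expression of a vector field in the preferred chart at `x₀`. -/
noncomputable def chartField (V : (p : M) → TangentSpace 𝓘(ℝ, E) p) (x₀ : M) : E → E :=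
  mpullbackWithin 𝓘(ℝ, E) 𝓘(ℝ, E) (extChartAt 𝓘(ℝ, E) x₀).symm V (Set.range 𝓘(ℝ, E))

section Field

variable [IsManifold 𝓘(ℝ, E) ∞ M]

theorem chartSymmDeriv_chartField (V : (p : M) → TangentSpace 𝓘(ℝ, E) p) {x₀ : M} {m : E}
    (hm : m ∈ (extChartAt 𝓘(ℝ, E) x₀).target) :
    chartSymmDeriv E x₀ m (chartField V x₀ m) = V ((extChartAt 𝓘(ℝ, E) x₀).symm m) := by
  have h := isInvertible_mfderivWithin_extChartAt_symm (I := 𝓘(ℝ, E)) hm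
  exact h.self_apply_inverse _

theorem differentiableAt_chartField [CompleteSpace E]
    {V : (p : M) → TangentSpace 𝓘(ℝ, E) p} {x₀ : M}
    (hV : CMDiffAt 1 (T% V) x₀) :
    DifferentiableAt ℝ (chartField V x₀) (extChartAt 𝓘(ℝ, E) x₀ x₀) := by
  have h := contMDiffWithinAt_mpullbackWithin_extChartAt_symm (I := 𝓘(ℝ, E)) (n := 2) (m := 1)
    hV.contMDiffWithinAt uniqueMDiffOn_univ (Set.mem_univ x₀) (by norm_num)
  rw [contMDiffWithinAt_vectorSpace_iff_contDiffWithinAt] at h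
  refine (h.contDiffAt ?_).differentiableAt (by simp)
  simpa using extChartAt_target_mem_nhds (I := 𝓘(ℝ, E)) x₀

/-- The preferred chart at `x₀` has identity derivative at `x₀`, so no transport back to the
manifold remains. -/
theorem mlieBracket_eq_lieBracket_chartField (V W : (p : M) → TangentSpace 𝓘(ℝ, E) p) (x₀ : M) :
    mlieBracket 𝓘(ℝ, E) V W x₀ =
      lieBracket ℝ (chartField V x₀) (chartField W x₀) (extChartAt 𝓘(ℝ, E) x₀ x₀) := by
  have h : ∀ u : E, (ContinuousLinearMap.id ℝ E).inverse u = u := fun u => by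
    rw [ContinuousLinearMap.inverse_id]
    rfl
  rw [mlieBracket, mlieBracketWithin_apply, mfderiv_extChartAt_self, ← lieBracketWithin_univ]
  simp only [Set.preimage_univ, Set.univ_inter, modelWithCornersSelf_coe, Set.range_id, chartField]
  exact h _

end Field

end ClosedForm

/-! ### The bracket identity for pullbacks between manifolds. -/

section PullbackForm

open Filter Topology VectorField

variable {E E' : Type*} [NormedAddCommGroup E] [NormedSpace ℝ E]
  [NormedAddCommGroup E'] [NormedSpace ℝ E']
  {M : Type*} [TopologicalSpace M] [ChartedSpace E M] [IsManifold 𝓘(ℝ, E) ∞ M]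
  {N : Type*} [TopologicalSpace N] [ChartedSpace E' N] [IsManifold 𝓘(ℝ, E') ∞ N]

theorem chartSymmDeriv_eq_mfderiv (x₀ : M) (m : E) : chartSymmDeriv E x₀ m =
    mfderiv 𝓘(ℝ, E) 𝓘(ℝ, E) (extChartAt 𝓘(ℝ, E) x₀).symm m := by
  rw [chartSymmDeriv, modelWithCornersSelf_coe, Set.range_id, mfderivWithin_univ]

theorem mdifferentiableAt_extChartAt_symm' {x₀ : M} {m : E}
    (hm : m ∈ (extChartAt 𝓘(ℝ, E) x₀).target) :
    MDifferentiableAt 𝓘(ℝ, E) 𝓘(ℝ, E) (extChartAt 𝓘(ℝ, E) x₀).symm m := by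
  have h := mdifferentiableWithinAt_extChartAt_symm (I := 𝓘(ℝ, E)) hm
  rwa [modelWithCornersSelf_coe, Set.range_id, mdifferentiableWithinAt_univ] at h

/-- The derivative of a map between manifolds, on the model spaces. -/
noncomputable def modelDeriv (E' E : Type*) [NormedAddCommGroup E] [NormedSpace ℝ E]
    [NormedAddCommGroup E'] [NormedSpace ℝ E'] {M : Type*} [TopologicalSpace M] [ChartedSpace E M]
    {N : Type*} [TopologicalSpace N] [ChartedSpace E' N] (ψ : N → M) (n : N) : E' →L[ℝ] E :=
  mfderiv 𝓘(ℝ, E') 𝓘(ℝ, E) ψ n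

theorem fderiv_writtenInExtChartAt {ψ : N → M} (hψ : ContMDiff 𝓘(ℝ, E') 𝓘(ℝ, E) ∞ ψ) {n₀ : N}
    {q : E'} (hq : q ∈ (extChartAt 𝓘(ℝ, E') n₀).target)
    (hψq : ψ ((extChartAt 𝓘(ℝ, E') n₀).symm q) ∈ (extChartAt 𝓘(ℝ, E) (ψ n₀)).source) (u : E') :
    fderiv ℝ (writtenInExtChartAt 𝓘(ℝ, E') 𝓘(ℝ, E) n₀ ψ) q u =
      chartDeriv E (ψ n₀) (ψ ((extChartAt 𝓘(ℝ, E') n₀).symm q))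
        (modelDeriv E' E ψ ((extChartAt 𝓘(ℝ, E') n₀).symm q) (chartSymmDeriv E' n₀ q u)) := by
  have h1 := mdifferentiableAt_extChartAt_symm' hq
  have h2 := (hψ ((extChartAt 𝓘(ℝ, E') n₀).symm q)).mdifferentiableAt (by simp)
  have h3 : MDifferentiableAt 𝓘(ℝ, E) 𝓘(ℝ, E) (extChartAt 𝓘(ℝ, E) (ψ n₀))
      (ψ ((extChartAt 𝓘(ℝ, E') n₀).symm q)) :=
    mdifferentiableAt_extChartAt (by simpa using hψq)
  have h4 := mfderiv_comp_apply q (g := extChartAt 𝓘(ℝ, E) (ψ n₀))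
    (f := ψ ∘ (extChartAt 𝓘(ℝ, E') n₀).symm) h3 (h2.comp q h1) u
  have h5 := mfderiv_comp_apply q h2 h1 u
  rw [chartSymmDeriv_eq_mfderiv, ← mfderiv_eq_fderiv]
  exact h4.trans (congrArg (chartDeriv E (ψ n₀) (ψ ((extChartAt 𝓘(ℝ, E') n₀).symm q))) h5)

theorem contDiffAt_writtenInExtChartAt {ψ : N → M} (hψ : ContMDiff 𝓘(ℝ, E') 𝓘(ℝ, E) ∞ ψ) (n₀ : N) :
    ContDiffAt ℝ ∞ (writtenInExtChartAt 𝓘(ℝ, E') 𝓘(ℝ, E) n₀ ψ)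
      (extChartAt 𝓘(ℝ, E') n₀ n₀) := by
  have h := (contMDiffAt_iff.1 (hψ n₀)).2
  rwa [modelWithCornersSelf_coe, Set.range_id, contDiffWithinAt_univ] at h

/-- If the pullback under `ψ` of a one-form that is closed at `ψ n₀` is constant on two vector
fields, then it annihilates their Lie bracket at `n₀`. -/
theorem apply_mfderiv_mlieBracket_eq_zero [CompleteSpace E'] {ψ : N → M}
    (hψ : ContMDiff 𝓘(ℝ, E') 𝓘(ℝ, E) ∞ ψ) {n₀ : N} {α : M → E →L[ℝ] ℝ}
    (hα : DifferentiableAt ℝ (chartForm α (ψ n₀)) (extChartAt 𝓘(ℝ, E) (ψ n₀) (ψ n₀)))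
    (hsymm : ∀ u v,
      fderiv ℝ (chartForm α (ψ n₀)) (extChartAt 𝓘(ℝ, E) (ψ n₀) (ψ n₀)) u v =
        fderiv ℝ (chartForm α (ψ n₀)) (extChartAt 𝓘(ℝ, E) (ψ n₀) (ψ n₀)) v u)
    {V W : (n : N) → TangentSpace 𝓘(ℝ, E') n} (hV : CMDiffAt 1 (T% V) n₀)
    (hW : CMDiffAt 1 (T% W) n₀) {CV CW : ℝ}
    (hαV : ∀ n, α (ψ n) (modelDeriv E' E ψ n (V n)) = CV)
    (hαW : ∀ n, α (ψ n) (modelDeriv E' E ψ n (W n)) = CW) :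
    α (ψ n₀) (modelDeriv E' E ψ n₀ (mlieBracket 𝓘(ℝ, E') V W n₀)) = 0 := by
  set c := extChartAt 𝓘(ℝ, E') n₀ n₀ with hc
  set p := writtenInExtChartAt 𝓘(ℝ, E') 𝓘(ℝ, E) n₀ ψ with hp
  have hpc : p c = extChartAt 𝓘(ℝ, E) (ψ n₀) (ψ n₀) := by
    simp [hp, hc, writtenInExtChartAt]
  -- The chart derivatives cancel against their inverses, so constancy on the manifold becomes
  -- constancy in coordinates near `c`.
  have key : ∀ {U : (n : N) → TangentSpace 𝓘(ℝ, E') n} {C : ℝ},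
      (∀ n, α (ψ n) (modelDeriv E' E ψ n (U n)) = C) →
      ∀ᶠ q in 𝓝 c, chartForm α (ψ n₀) (p q) (fderiv ℝ p q (chartField U n₀ q)) = C := by
    intro U C hU
    have h1 : ContinuousAt (fun q => ψ ((extChartAt 𝓘(ℝ, E') n₀).symm q)) c :=
      ContinuousAt.comp hψ.continuous.continuousAt (continuousAt_extChartAt_symm n₀)
    have h2 : ψ ((extChartAt 𝓘(ℝ, E') n₀).symm c) = ψ n₀ := by simp [hc]
    have h3 : (extChartAt 𝓘(ℝ, E) (ψ n₀)).source ∈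
        𝓝 (ψ ((extChartAt 𝓘(ℝ, E') n₀).symm c)) := by
      rw [h2]
      exact extChartAt_source_mem_nhds (ψ n₀)
    filter_upwards [extChartAt_target_mem_nhds (I := 𝓘(ℝ, E')) n₀, h1 h3] with q hq hq'
    have h4 := fderiv_writtenInExtChartAt hψ hq hq' (chartField U n₀ q)
    rw [chartSymmDeriv_chartField U hq] at h4
    have h5 := chartForm_apply_chartDeriv α hq'
      (modelDeriv E' E ψ ((extChartAt 𝓘(ℝ, E') n₀).symm q) (U ((extChartAt 𝓘(ℝ, E') n₀).symm q)))
    exact (congrArg _ h4).trans (h5.trans (hU _))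
  have h1 := apply_fderiv_lieBracket_eq_zero (c := c) (p := p) (θ := chartForm α (ψ n₀))
    ((contDiffAt_writtenInExtChartAt hψ n₀).of_le ENat.LEInfty.out) (by rwa [hpc]) (by rwa [hpc])
    (differentiableAt_chartField hV) (differentiableAt_chartField hW) (key hαV) (key hαW)
  have hsrc := mem_extChartAt_source (I := 𝓘(ℝ, E)) (ψ n₀)
  have h2 := fderiv_writtenInExtChartAt hψ (mem_extChartAt_target (I := 𝓘(ℝ, E')) n₀)
    (by rw [extChartAt_to_inv]; exact hsrc)
    (lieBracket ℝ (chartField V n₀) (chartField W n₀) c)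
  rw [← hp, ← hc, chartSymmDeriv_self, hc, extChartAt_to_inv, ← hc] at h2
  rw [h2, hpc, chartForm_apply_chartDeriv α hsrc] at h1
  exact (congrArg (fun u => α (ψ n₀) (modelDeriv E' E ψ n₀ u))
    (mlieBracket_eq_lieBracket_chartField V W n₀)).trans h1

end PullbackForm

/-! ### The dual form of a parallel field is closed. -/

section ParallelForm

open Filter Topology VectorField

variable {E : Type*} [NormedAddCommGroup E] [NormedSpace ℝ E] [FiniteDimensional ℝ E]
  {M : Type*} [TopologicalSpace M] [ChartedSpace E M] [IsManifold 𝓘(ℝ, E) ∞ M]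

/-- The coordinate vector field with constant value `u` in the preferred chart at `x₀`. -/
noncomputable def coordField (x₀ : M) (u : E) : (p : M) → TangentSpace 𝓘(ℝ, E) p :=
  mpullback 𝓘(ℝ, E) 𝓘(ℝ, E) (extChartAt 𝓘(ℝ, E) x₀) (fun _ => u)

theorem mdifferentiableAt_constField (u m : E) :
    MDifferentiableAt 𝓘(ℝ, E) 𝓘(ℝ, E).tangent
      (fun x => (⟨x, u⟩ : TangentBundle 𝓘(ℝ, E) E)) m := by
  have h : ContMDiffAt 𝓘(ℝ, E) 𝓘(ℝ, E).tangent 1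
      (fun x => (⟨x, u⟩ : TangentBundle 𝓘(ℝ, E) E)) m :=
    contMDiffAt_vectorSpace_iff_contDiffAt.2 contDiffAt_const
  exact h.mdifferentiableAt (by simp)

theorem coordField_symm (x₀ : M) {m : E} (hm : m ∈ (extChartAt 𝓘(ℝ, E) x₀).target) (u : E) :
    coordField x₀ u ((extChartAt 𝓘(ℝ, E) x₀).symm m) = chartSymmDeriv E x₀ m u := by
  have h := isInvertible_mfderiv_extChartAt (I := 𝓘(ℝ, E)) ((extChartAt 𝓘(ℝ, E) x₀).map_target hm)
  exact (h.inverse_apply_eq).2 (chartDeriv_chartSymmDeriv hm u).symm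

theorem coordField_self (x₀ : M) (u : E) : coordField x₀ u x₀ = u := by
  have h := coordField_symm x₀ (mem_extChartAt_target (I := 𝓘(ℝ, E)) x₀) u
  rwa [chartSymmDeriv_self, extChartAt_to_inv] at h

theorem mdifferentiableAt_coordField (x₀ : M) (u : E) : MDiffAt (T% (coordField x₀ u)) x₀ :=
  MDifferentiableAt.mpullback_vectorField (n := 2) (mdifferentiableAt_constField u _)
    contMDiffAt_extChartAt (isInvertible_mfderiv_extChartAt (mem_extChartAt_source x₀)) le_rfl

theorem mlieBracket_coordField (x₀ : M) (u v : E) :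
    mlieBracket 𝓘(ℝ, E) (coordField x₀ u) (coordField x₀ v) x₀ = 0 := by
  have : IsManifold 𝓘(ℝ, E) (minSmoothness ℝ 2) M := by
    rw [minSmoothness_of_isRCLikeNormedField]
    infer_instance
  have : IsManifold 𝓘(ℝ, E) (minSmoothness ℝ 2) E := by
    rw [minSmoothness_of_isRCLikeNormedField]
    infer_instance
  have h := mpullback_mlieBracket (I := 𝓘(ℝ, E)) (I' := 𝓘(ℝ, E)) (n := 2) (x₀ := x₀)
    (f := extChartAt 𝓘(ℝ, E) x₀)
    (mdifferentiableAt_constField u _) (mdifferentiableAt_constField v _)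
    contMDiffAt_extChartAt (by simp)
  refine h.symm.trans ?_
  have h0 : mlieBracket 𝓘(ℝ, E) (fun _ : E => u) (fun _ => v) (extChartAt 𝓘(ℝ, E) x₀ x₀) =
      (0 : E) := by
    refine (congrFun (mlieBracketWithin_eq_lieBracketWithin (V := fun _ : E => u)
      (W := fun _ => v) (s := Set.univ)) _).trans ?_
    simp [lieBracketWithin]
    rfl
  exact (congrArg _ h0).trans (map_zero _)

variable (a : RiemannianMetricOn E M) {X : (x : M) → TangentSpace 𝓘(ℝ, E) x}

/-- The one-form dual to a vector field. -/
noncomputable def dualForm (a : RiemannianMetricOn E M) (X : (x : M) → TangentSpace 𝓘(ℝ, E) x) (p : M) :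
    E →L[ℝ] ℝ :=
  a.inner p (X p)

theorem chartForm_dualForm_eventuallyEq (X : (x : M) → TangentSpace 𝓘(ℝ, E) x) (x₀ : M) (u : E) :
    (fun m => chartForm (dualForm a X) x₀ m u) =ᶠ[𝓝 (extChartAt 𝓘(ℝ, E) x₀ x₀)]
      (fun p => a.inner p (X p) (coordField x₀ u p)) ∘ (extChartAt 𝓘(ℝ, E) x₀).symm := by
  filter_upwards [extChartAt_target_mem_nhds (I := 𝓘(ℝ, E)) x₀] with m hm
  rw [Function.comp_apply, coordField_symm x₀ hm]
  rfl

/-- The coefficients of the form are inner products with coordinate fields, so metric compatibility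
of the connection applies to their derivatives. -/
theorem hasFDerivAt_chartForm_dualForm {x₀ : M} (hX : MDiffAt (T% X) x₀) (u : E) :
    HasFDerivAt (fun m => chartForm (dualForm a X) x₀ m u)
      (mvfderiv 𝓘(ℝ, E) (fun p => a.inner p (X p) (coordField x₀ u p)) x₀ : E →L[ℝ] ℝ)
      (extChartAt 𝓘(ℝ, E) x₀ x₀) := by
  have h1 := a.mdifferentiableAt_inner hX (mdifferentiableAt_coordField x₀ u)
  have h2 : HasFDerivWithinAt ((fun p => a.inner p (X p) (coordField x₀ u p)) ∘
        (extChartAt 𝓘(ℝ, E) x₀).symm)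
      (mvfderiv 𝓘(ℝ, E) (fun p => a.inner p (X p) (coordField x₀ u p)) x₀ : E →L[ℝ] ℝ)
      (Set.range 𝓘(ℝ, E)) (extChartAt 𝓘(ℝ, E) x₀ x₀) := h1.hasMFDerivAt.2
  have h3 := h2.hasFDerivAt (by simp)
  exact HasFDerivAt.congr_of_eventuallyEq h3 (chartForm_dualForm_eventuallyEq a X x₀ u)

theorem differentiableAt_chartForm_dualForm {x₀ : M} (hX : MDiffAt (T% X) x₀) :
    DifferentiableAt ℝ (chartForm (dualForm a X) x₀) (extChartAt 𝓘(ℝ, E) x₀ x₀) :=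
  differentiableAt_clm_of_apply fun u => (hasFDerivAt_chartForm_dualForm a hX u).differentiableAt

/-- The one-form dual to a vector field that is parallel at `x₀` is closed at `x₀`. -/
theorem fderiv_chartForm_dualForm_comm
    {D : CovariantDerivative 𝓘(ℝ, E) E (TangentSpace 𝓘(ℝ, E) : M → Type _)}
    (hLC : IsLeviCivita a D) {x₀ : M} (hX : MDiffAt (T% X) x₀) (hD : ∀ w, D X x₀ w = 0)
    (u v : E) :
    fderiv ℝ (chartForm (dualForm a X) x₀) (extChartAt 𝓘(ℝ, E) x₀ x₀) u v =
      fderiv ℝ (chartForm (dualForm a X) x₀) (extChartAt 𝓘(ℝ, E) x₀ x₀) v u := by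
  -- Since `X` is parallel at `x₀`, differentiating `ã(X, ∂_v)` along `u` leaves `ã(X, ∇_u ∂_v)`.
  have key : ∀ (u : TangentSpace 𝓘(ℝ, E) x₀) (v : E),
      fderiv ℝ (chartForm (dualForm a X) x₀) (extChartAt 𝓘(ℝ, E) x₀ x₀) u v =
        a.inner x₀ (X x₀) (D (coordField x₀ v) x₀ u) := by
    intro u v
    have h0 := ((differentiableAt_chartForm_dualForm a hX).hasFDerivAt.clm_apply
      (hasFDerivAt_const v _)).unique (hasFDerivAt_chartForm_dualForm a hX v)
    have h2 := congrArg (fun L : E →L[ℝ] ℝ => L u) h0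
    simp only [ContinuousLinearMap.comp_zero, zero_add] at h2
    have h3 := hLC.2 x₀ X (coordField x₀ v) hX (mdifferentiableAt_coordField x₀ v) u
    rw [hD, map_zero, zero_apply, zero_add] at h3
    exact h2.trans h3
  -- Coordinate fields commute at `x₀`, so vanishing torsion gives `∇_u ∂_v = ∇_v ∂_u`.
  have h1 := D.torsion_eq_zero_iff.1 hLC.1 (mdifferentiableAt_coordField x₀ u)
    (mdifferentiableAt_coordField x₀ v)
  rw [mlieBracket_coordField, coordField_self, coordField_self, sub_eq_zero] at h1
  exact (key u v).trans ((congrArg (a.inner x₀ (X x₀)) h1).trans (key v u).symm)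

end ParallelForm

/-! ### Curves in level sets of a submersion. -/

section ImplicitCurve

open Filter Topology

/-- A vector in the kernel of a surjective derivative is tangent to a smooth curve in the level
set. -/
theorem exists_curve_in_levelSet {E F : Type*} [NormedAddCommGroup E] [NormedSpace ℝ E]
    [CompleteSpace E] [NormedAddCommGroup F] [NormedSpace ℝ F] [FiniteDimensional ℝ F]
    {p : E → F} {c : E} (hp : ContDiffAt ℝ ∞ p c)
    (hsurj : Function.Surjective (fderiv ℝ p c)) {u : E} (hu : fderiv ℝ p c u = 0) :
    ∃ x : ℝ → E, x 0 = c ∧ ContDiffAt ℝ ∞ x 0 ∧ HasDerivAt x u 0 ∧ ∀ᶠ t in 𝓝 0, p (x t) = p c := by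
  have : CompleteSpace F := FiniteDimensional.complete ℝ F
  obtain ⟨R₀, hR₀⟩ := (fderiv ℝ p c : E →ₗ[ℝ] F).exists_rightInverse_of_surjective
    (LinearMap.range_eq_top.2 hsurj)
  let R : F →L[ℝ] E := LinearMap.toContinuousLinearMap R₀
  have hR : ∀ s, fderiv ℝ p c (R s) = s := fun s => congrArg (fun L : F →ₗ[ℝ] F => L s) hR₀
  let ξ : ℝ × F → E := fun z => c + (z.1 • u + R z.2)
  let ξ' : ℝ × F →L[ℝ] E :=
    (ContinuousLinearMap.fst ℝ ℝ F).smulRight u + R.comp (ContinuousLinearMap.snd ℝ ℝ F)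
  have hξ : ∀ z, HasFDerivAt ξ ξ' z := fun z => ξ'.hasFDerivAt.const_add c
  have hξs : ContDiff ℝ ∞ ξ := contDiff_const.add ξ'.contDiff
  have hξ0 : ξ 0 = c := by simp [ξ]
  -- Because `p' u = 0` and `p' R = id`, the derivative of `Ψ` at `0` is the identity. The curve is
  -- the image under `ξ` of the local inverse on the line `(t, p c)`; its velocity is `ξ'(1, 0) =
  -- u`.
  let Ψ : ℝ × F → ℝ × F := fun z => (z.1, p (ξ z))
  have hps : ContDiffAt ℝ ∞ p (ξ 0) := by rwa [hξ0]
  have hΨs : ContDiffAt ℝ ∞ Ψ 0 := contDiffAt_fst.prodMk (hps.comp 0 hξs.contDiffAt)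
  have hΨ : HasFDerivAt Ψ
      ((ContinuousLinearEquiv.refl ℝ (ℝ × F) : (ℝ × F) ≃L[ℝ] ℝ × F) : (ℝ × F) →L[ℝ] ℝ × F) 0 := by
    have h1 : HasFDerivAt p (fderiv ℝ p c) (ξ 0) := by
      rw [hξ0]
      exact (hp.differentiableAt (by simp)).hasFDerivAt
    have h2 : HasFDerivAt Ψ _ 0 :=
      (hasFDerivAt_fst (𝕜 := ℝ) (p := (0 : ℝ × F))).prodMk (h1.comp 0 (hξ 0))
    refine h2.congr_fderiv ?_
    ext z <;> simp [ξ', hu, hR]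
  have hΨ0 : Ψ 0 = (0, p c) := by simp [Ψ, hξ0]
  let hstrict := hΨs.hasStrictFDerivAt' hΨ (by simp)
  let σ : ℝ × F → ℝ × F := hΨs.localInverse hΨ (by simp)
  have hσs : ContDiffAt ℝ ∞ σ (0, p c) := hΨ0 ▸ hΨs.to_localInverse hΨ (by simp)
  have hσ0 : σ (0, p c) = 0 := hΨ0 ▸ hΨs.localInverse_apply_image hΨ (by simp)
  have hσd : HasFDerivAt σ (ContinuousLinearMap.id ℝ (ℝ × F)) (0, p c) :=
    hΨ0 ▸ hstrict.to_localInverse.hasFDerivAt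
  have hσr : ∀ᶠ z in 𝓝 ((0 : ℝ), p c), Ψ (σ z) = z := hΨ0 ▸ hstrict.eventually_right_inverse
  let ι : ℝ → ℝ × F := fun t => (t, p c)
  have hι : HasDerivAt ι ((1 : ℝ), (0 : F)) 0 := (hasDerivAt_id 0).prodMk (hasDerivAt_const _ _)
  have hιs : ContDiff ℝ ∞ ι := contDiff_id.prodMk contDiff_const
  refine ⟨fun t => ξ (σ (ι t)), ?_, ?_, ?_, ?_⟩
  · change ξ (σ (0, p c)) = c
    rw [hσ0, hξ0]
  · exact hξs.contDiffAt.comp 0 (ContDiffAt.comp (0 : ℝ) (g := σ) hσs hιs.contDiffAt)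
  · have h1 : HasDerivAt (σ ∘ ι) (ContinuousLinearMap.id ℝ (ℝ × F) ((1 : ℝ), (0 : F))) 0 :=
      HasFDerivAt.comp_hasDerivAt (0 : ℝ) hσd hι
    have h2 := (hξ (σ (ι 0))).comp_hasDerivAt (0 : ℝ) h1
    have h3 : ξ' (ContinuousLinearMap.id ℝ (ℝ × F) ((1 : ℝ), (0 : F))) = u := by simp [ξ']
    rw [h3] at h2
    exact h2
  · filter_upwards [hιs.continuous.continuousAt.eventually hσr] with t ht
    exact congrArg Prod.snd ht

end ImplicitCurve

/-! ### The Lie algebra of `H` as the kernel of the projection's differential. -/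

section Homogeneous

open Filter Topology VectorField

variable {EG : Type*} [NormedAddCommGroup EG] [NormedSpace ℝ EG]
  {G : Type*} [TopologicalSpace G] [ChartedSpace EG G] [Group G]
  {EM : Type*} [NormedAddCommGroup EM] [NormedSpace ℝ EM]
  {H : Subgroup G} [ChartedSpace EM (G ⧸ H)]

/-- The differential at the identity of the projection `G → G ⧸ H`, on the model spaces. -/
noncomputable def originDeriv (EG EM : Type*) [NormedAddCommGroup EG] [NormedSpace ℝ EG]
    {G : Type*} [TopologicalSpace G] [ChartedSpace EG G] [Group G]
    [NormedAddCommGroup EM] [NormedSpace ℝ EM] (H : Subgroup G) [ChartedSpace EM (G ⧸ H)] :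
    EG →L[ℝ] EM :=
  modelDeriv EG EM (fun g : G => (g : G ⧸ H)) 1

theorem toTangent_eq_zero_of_isVelocityIn (hM : IsHomogeneousManifold EG EM H)
    {v : LieAlg EG G} (hv : IsVelocityIn H v) : originDeriv EG EM H v = 0 := by
  obtain ⟨γ, h0, hH, hs, hd⟩ := hv
  have h1 := mfderiv_comp_apply_of_eq (I := 𝓘(ℝ, ℝ)) (I' := 𝓘(ℝ, EG)) (I'' := 𝓘(ℝ, EM)) (0 : ℝ)
    (f := γ) (g := fun g : G => (g : G ⧸ H)) (y := 1)
    ((hM.smooth 1).mdifferentiableAt (by simp)) (hs.mdifferentiableAt (by simp)) h0 (1 : ℝ)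
  have h2 : (fun g : G => (g : G ⧸ H)) ∘ γ = fun _ => origin H := by
    funext t
    exact QuotientGroup.eq.2 (by simpa using hH t)
  have h3 : (mfderiv 𝓘(ℝ, ℝ) 𝓘(ℝ, EM) ((fun g : G => (g : G ⧸ H)) ∘ γ) 0 (1 : ℝ) : EM) = 0 := by
    rw [h2, mfderiv_const]
    rfl
  exact (congrArg (originDeriv EG EM H) hd).symm.trans (h1.symm.trans h3)

variable [LieGroup 𝓘(ℝ, EG) ∞ G]

/-- The projection is a submersion, so a kernel vector is tangent to a smooth curve in the fibre
over `o`, and that fibre is `H`. -/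
theorem isVelocityIn_of_originDeriv_eq_zero [FiniteDimensional ℝ EG] [FiniteDimensional ℝ EM]
    [IsManifold 𝓘(ℝ, EM) ∞ (G ⧸ H)]
    (hM : IsHomogeneousManifold EG EM H) {v : EG} (hv : originDeriv EG EM H v = 0) :
    IsVelocityIn H (v : LieAlg EG G) := by
  classical
  have : CompleteSpace EG := FiniteDimensional.complete ℝ EG
  have : IsManifold 𝓘(ℝ, EG) ∞ G := inferInstance
  set ψ : G → G ⧸ H := fun g => (g : G ⧸ H) with hψ
  set e := extChartAt 𝓘(ℝ, EG) (1 : G) with he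
  set c := e 1 with hc
  set p := writtenInExtChartAt 𝓘(ℝ, EG) 𝓘(ℝ, EM) (1 : G) ψ with hp
  have hsrc := mem_extChartAt_source (I := 𝓘(ℝ, EM)) (ψ 1)
  have hec : e.symm c = 1 := extChartAt_to_inv 1
  have hder : ∀ u, fderiv ℝ p c u = originDeriv EG EM H u := by
    intro u
    have h := fderiv_writtenInExtChartAt (ψ := ψ) hM.smooth
      (mem_extChartAt_target (I := 𝓘(ℝ, EG)) (1 : G))
      (by rw [extChartAt_to_inv]; exact hsrc) u
    rw [extChartAt_to_inv, chartSymmDeriv_self, chartDeriv_self] at h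
    exact h
  obtain ⟨x, hx0, hxs, hxd, hxp⟩ := exists_curve_in_levelSet
    (contDiffAt_writtenInExtChartAt (ψ := ψ) hM.smooth 1)
    (fun w => by
      obtain ⟨u, hu⟩ := hM.submersion 1 w
      exact ⟨u, (hder u).trans hu⟩) ((hder v).trans hv)
  have hes : ContMDiffAt 𝓘(ℝ, EG) 𝓘(ℝ, EG) ∞ e.symm (x 0) := by
    rw [hx0]
    have h := contMDiffWithinAt_extChartAt_symm_range_self (I := 𝓘(ℝ, EG)) (n := ∞) (1 : G)
    rwa [modelWithCornersSelf_coe, Set.range_id, contMDiffWithinAt_univ] at h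
  have hcurve : ContMDiffAt 𝓘(ℝ, ℝ) 𝓘(ℝ, EG) ∞ (fun t => e.symm (x t)) 0 :=
    ContMDiffAt.comp (0 : ℝ) hes hxs.contMDiffAt
  have hmem : ∀ᶠ t in 𝓝 (0 : ℝ), e.symm (x t) ∈ H := by
    have h1 : ContinuousAt (fun t => ψ (e.symm (x t))) 0 :=
      ContinuousAt.comp (g := ψ) hM.smooth.continuous.continuousAt hcurve.continuousAt
    have h2 : (extChartAt 𝓘(ℝ, EM) (ψ 1)).source ∈ 𝓝 (ψ (e.symm (x 0))) := by
      rw [hx0, hec]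
      exact extChartAt_source_mem_nhds (ψ 1)
    filter_upwards [hxp, h1 h2] with t ht ht'
    have h3 : ψ (e.symm (x t)) = ψ 1 := by
      refine (extChartAt 𝓘(ℝ, EM) (ψ 1)).injOn ht' hsrc ?_
      refine Eq.trans ht ?_
      change extChartAt 𝓘(ℝ, EM) (ψ 1) (ψ (e.symm c)) = _
      rw [hec]
    simpa using QuotientGroup.eq.1 h3.symm
  -- The curve lies in `H` only for small `t`; the value `1` elsewhere keeps it in `H` for all times
  -- without changing its germ at `0`.
  let γ : ℝ → G := fun t => if e.symm (x t) ∈ H then e.symm (x t) else 1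
  have hγ : γ =ᶠ[𝓝 0] fun t => e.symm (x t) := hmem.mono fun t ht => if_pos ht
  refine ⟨γ, ?_, fun t => ?_, hcurve.congr_of_eventuallyEq hγ, ?_⟩
  · refine hγ.self_of_nhds.trans ?_
    change e.symm (x 0) = 1
    rw [hx0]
    exact hec
  · by_cases h : e.symm (x t) ∈ H
    · simp only [γ, if_pos h]; exact h
    · simp only [γ, if_neg h]; exact H.one_mem
  · have h1 := hγ.mfderiv_eq (I := 𝓘(ℝ, ℝ)) (I' := 𝓘(ℝ, EG))
    have h2 := mfderiv_comp_apply (I := 𝓘(ℝ, ℝ)) (I' := 𝓘(ℝ, EG)) (I'' := 𝓘(ℝ, EG)) (0 : ℝ)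
      (g := e.symm) (f := x) (hes.mdifferentiableAt (by simp))
      (hxs.contMDiffAt.mdifferentiableAt (by simp)) (1 : ℝ)
    have h3 : (mfderiv 𝓘(ℝ, ℝ) 𝓘(ℝ, EG) x 0 (1 : ℝ) : EG) = v := by
      rw [mfderiv_eq_fderiv]
      exact (congrArg (fun L : ℝ →L[ℝ] EG => L 1) hxd.hasFDerivAt.fderiv).trans (by simp)
    have h4 : ∀ u : EG, (mfderiv 𝓘(ℝ, EG) 𝓘(ℝ, EG) e.symm (x 0) u : EG) = u := by
      intro u
      have h5 := chartSymmDeriv_eq_mfderiv (1 : G) (E := EG) c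
      rw [hx0]
      exact (congrArg (fun L : EG →L[ℝ] EG => L u) h5).symm.trans
        (congrArg (fun L : EG →L[ℝ] EG => L u) (chartSymmDeriv_self (E := EG) (1 : G)))
    exact (congrArg (fun L : ℝ →L[ℝ] EG => L 1) h1).trans (h2.trans ((h4 _).trans h3))

/-- The Lie algebra of `H` is the kernel of the differential of the projection. -/
theorem mem_subgroupLieAlg_iff [FiniteDimensional ℝ EG] [FiniteDimensional ℝ EM]
    [IsManifold 𝓘(ℝ, EM) ∞ (G ⧸ H)] (hM : IsHomogeneousManifold EG EM H) {v : LieAlg EG G} :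
    v ∈ subgroupLieAlg H ↔ originDeriv EG EM H v = 0 :=
  ⟨toTangent_eq_zero_of_isVelocityIn hM, isVelocityIn_of_originDeriv_eq_zero hM⟩

end Homogeneous

/-! ### The invariant form on `G` and its vanishing on brackets. -/

section Invariance

open Filter Topology VectorField

variable {EG : Type*} [NormedAddCommGroup EG] [NormedSpace ℝ EG]
  {G : Type*} [TopologicalSpace G] [ChartedSpace EG G] [Group G] [LieGroup 𝓘(ℝ, EG) ∞ G]
  {EM : Type*} [NormedAddCommGroup EM] [NormedSpace ℝ EM]
  {H : Subgroup G} [ChartedSpace EM (G ⧸ H)] [IsManifold 𝓘(ℝ, EM) ∞ (G ⧸ H)]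
  {a : RiemannianMetricOn EM (G ⧸ H)} {X : (x : G ⧸ H) → TangentSpace 𝓘(ℝ, EM) x}

/-- The pullback to `G` of the one-form dual to an invariant vector field is left invariant. -/
theorem dualForm_mulInvariantVectorField (hM : IsHomogeneousManifold EG EM H)
    (ha : IsInvariantMetric a) (hX : IsInvariantField X) (v : LieAlg EG G) (g : G) :
    dualForm a X (g : G ⧸ H)
        (modelDeriv EG EM (fun g : G => (g : G ⧸ H)) g (mulInvariantVectorField v g)) =
      dualForm a X (origin H) (originDeriv EG EM H v) := by
  by_cases hd : MDifferentiableAt 𝓘(ℝ, EM) 𝓘(ℝ, EM) (fun p : G ⧸ H => g • p) (origin H)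
  · have h1 := mfderiv_comp_apply_of_eq (I := 𝓘(ℝ, EG)) (I' := 𝓘(ℝ, EG)) (I'' := 𝓘(ℝ, EM)) (1 : G)
      (f := fun x => g * x) (g := fun g : G => (g : G ⧸ H)) (y := g)
      ((hM.smooth g).mdifferentiableAt (by simp))
      ((contMDiff_mul_left (I := 𝓘(ℝ, EG)) (n := ∞)).mdifferentiableAt (by simp)) (mul_one g) v
    have h2 := mfderiv_comp_apply (I := 𝓘(ℝ, EG)) (I' := 𝓘(ℝ, EM)) (I'' := 𝓘(ℝ, EM)) (1 : G)
      (f := fun g : G => (g : G ⧸ H)) (g := fun p : G ⧸ H => g • p) hd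
      ((hM.smooth 1).mdifferentiableAt (by simp)) v
    have h3 : (modelDeriv EG EM (fun g : G => (g : G ⧸ H)) g (mulInvariantVectorField v g) : EM) =
        mfderiv 𝓘(ℝ, EM) 𝓘(ℝ, EM) (fun p : G ⧸ H => g • p) (origin H)
          (originDeriv EG EM H v) := h1.symm.trans h2
    have h4 := ha g (origin H) (X (origin H)) (originDeriv EG EM H v)
    rw [hX] at h4
    have h5 : g • origin H = (g : G ⧸ H) := congrArg QuotientGroup.mk (mul_one g)
    rw [← h5]
    exact (congrArg (dualForm a X (g • origin H)) h3).trans h4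
  -- If translation by `g` is not differentiable at `o`, its `mfderiv` is zero by convention.
  -- Invariance of the metric then makes the tangent space trivial, and both sides vanish.
  · have h1 : ∀ u : EM, u = 0 := by
      intro u
      by_contra hu
      have h2 := ha g (origin H) u u
      rw [mfderiv_zero_of_not_mdifferentiableAt hd] at h2
      exact (a.pos (origin H) u hu).ne
        ((map_zero (a.inner (g • origin H) (0 : TangentSpace 𝓘(ℝ, EM) (g • origin H)))).symm.trans h2)
    have h2 : ∀ (β : EM →L[ℝ] ℝ) (u : EM), β u = 0 := fun β u => by rw [h1 u, map_zero]
    exact (h2 _ _).trans (h2 _ _).symm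

/-- The dual form is closed at `o` and its pullback is constant on left-invariant fields, whose
bracket at `1` is the Lie algebra bracket. -/
theorem dualForm_bracket_eq_zero [FiniteDimensional ℝ EG] [FiniteDimensional ℝ EM]
    (hM : IsHomogeneousManifold EG EM H)
    (ha : IsInvariantMetric a) (hX : IsInvariantField X)
    {D : CovariantDerivative 𝓘(ℝ, EM) EM (TangentSpace 𝓘(ℝ, EM) : G ⧸ H → Type _)}
    (hLC : IsLeviCivita a D) (hXd : MDiffAt (T% X) (origin H))
    (hD : ∀ w, D X (origin H) w = 0) (y z : LieAlg EG G) :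
    dualForm a X (origin H) (originDeriv EG EM H (⁅y, z⁆ : LieAlg EG G)) = 0 := by
  have : LieGroup 𝓘(ℝ, EG) (minSmoothness ℝ 3) G := by
    rw [minSmoothness_of_isRCLikeNormedField]
    exact LieGroup.of_le (n := ∞) ENat.LEInfty.out
  have : CompleteSpace EG := FiniteDimensional.complete ℝ EG
  have hs : ∀ v : LieAlg EG G, CMDiffAt 1 (T% (mulInvariantVectorField v)) (1 : G) := fun v =>
    (contMDiffAt_mulInvariantVectorField v).of_le (by
      rw [minSmoothness_of_isRCLikeNormedField]
      norm_num)
  exact apply_mfderiv_mlieBracket_eq_zero (ψ := fun g : G => (g : G ⧸ H)) (n₀ := 1) hM.smooth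
    (differentiableAt_chartForm_dualForm a hXd) (fderiv_chartForm_dualForm_comm a hLC hXd hD)
    (hs y) (hs z) (dualForm_mulInvariantVectorField hM ha hX y)
    (dualForm_mulInvariantVectorField hM ha hX z)

/-- The difference `v - v_𝔪` lies in `𝔥`, which the projection kills. -/
theorem originDeriv_projection (hM : IsHomogeneousManifold EG EM H)
    {𝔪 : Submodule ℝ (LieAlg EG G)} (h𝔪 : IsReductiveDecomposition H 𝔪) (v : LieAlg EG G) :
    originDeriv EG EM H (𝔪.projection (subgroupLieAlg H) h𝔪.isCompl v) =
      originDeriv EG EM H v := by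
  have h := toTangent_eq_zero_of_isVelocityIn hM
    (Submodule.sub_projection_mem h𝔪.isCompl v : IsVelocityIn H _)
  exact (sub_eq_zero.1 ((map_sub (originDeriv EG EM H) v _).symm.trans h)).symm

/-- This needs the kernel to be no larger than `𝔥`, and ensures that the pulled-back metric is
positive at nonzero vectors of `𝔪`. -/
theorem originDeriv_ne_zero [FiniteDimensional ℝ EG] [FiniteDimensional ℝ EM]
    (hM : IsHomogeneousManifold EG EM H)
    {𝔪 : Submodule ℝ (LieAlg EG G)} (h𝔪 : IsReductiveDecomposition H 𝔪) {v : LieAlg EG G}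
    (hv : v ∈ 𝔪) (hv0 : v ≠ 0) : originDeriv EG EM H v ≠ 0 := fun h =>
  hv0 (Submodule.disjoint_def.1 h𝔪.isCompl.disjoint v hv ((mem_subgroupLieAlg_iff hM).2 h))

theorem bracketM_add {𝔪 : Submodule ℝ (LieAlg EG G)} (h𝔪 : IsReductiveDecomposition H 𝔪)
    [CompleteSpace EG] (x y z : LieAlg EG G) :
    bracketM h𝔪 x (y + z) = bracketM h𝔪 x y + bracketM h𝔪 x z := by
  have : LieGroup 𝓘(ℝ, EG) (minSmoothness ℝ 3) G := by
    rw [minSmoothness_of_isRCLikeNormedField]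
    exact LieGroup.of_le (n := ∞) ENat.LEInfty.out
  rw [bracketM, lie_add, map_add]
  rfl

theorem bracketM_smul {𝔪 : Submodule ℝ (LieAlg EG G)} (h𝔪 : IsReductiveDecomposition H 𝔪)
    [CompleteSpace EG] (c : ℝ) (x y : LieAlg EG G) :
    bracketM h𝔪 x (c • y) = c • bracketM h𝔪 x y := by
  have : LieGroup 𝓘(ℝ, EG) (minSmoothness ℝ 3) G := by
    rw [minSmoothness_of_isRCLikeNormedField]
    exact LieGroup.of_le (n := ∞) ENat.LEInfty.out
  rw [bracketM, lie_smul, map_smul]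
  rfl

end Invariance

/-! ### Equivalence of the two natural reductivity conditions. -/

section NaturallyReductive

variable {EG : Type*} [NormedAddCommGroup EG] [NormedSpace ℝ EG]
  {G : Type*} [TopologicalSpace G] [ChartedSpace EG G] [Group G] [LieGroup 𝓘(ℝ, EG) ∞ G]
  {EM : Type*} [NormedAddCommGroup EM] [NormedSpace ℝ EM]
  {H : Subgroup G} [ChartedSpace EM (G ⧸ H)] [IsManifold 𝓘(ℝ, EM) ∞ (G ⧸ H)]
  {a : RiemannianMetricOn EM (G ⧸ H)} {X : (x : G ⧸ H) → TangentSpace 𝓘(ℝ, EM) x}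
  {φ : ℝ → ℝ} {b₀ : ℝ}

/-- The linear map `w ↦ [x, w_𝔪]_𝔪`. -/
noncomputable def bracketMap [FiniteDimensional ℝ EG] {𝔪 : Submodule ℝ (LieAlg EG G)}
    (h𝔪 : IsReductiveDecomposition H 𝔪) (x : LieAlg EG G) : EG →L[ℝ] EG :=
  have : CompleteSpace EG := FiniteDimensional.complete ℝ EG
  let A : LieAlg EG G →ₗ[ℝ] LieAlg EG G :=
    { toFun := fun w => bracketM h𝔪 x (𝔪.projection (subgroupLieAlg H) h𝔪.isCompl w)
      map_add' := fun u v => by rw [map_add, bracketM_add]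
      map_smul' := fun c u => by rw [map_smul, bracketM_smul]; rfl }
  LinearMap.toContinuousLinearMap (E := EG) (F' := EG) A

theorem bracketMap_apply [FiniteDimensional ℝ EG] {𝔪 : Submodule ℝ (LieAlg EG G)}
    (h𝔪 : IsReductiveDecomposition H 𝔪) (x w : LieAlg EG G) :
    bracketMap h𝔪 x w = bracketM h𝔪 x (𝔪.projection (subgroupLieAlg H) h𝔪.isCompl w) := rfl

theorem bracketMap_apply_of_mem [FiniteDimensional ℝ EG] {𝔪 : Submodule ℝ (LieAlg EG G)}
    (h𝔪 : IsReductiveDecomposition H 𝔪) (x : LieAlg EG G) {w : LieAlg EG G} (hw : w ∈ 𝔪) :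
    bracketMap h𝔪 x w = bracketM h𝔪 x w := by
  rw [bracketMap_apply, Submodule.projection_apply_of_mem_left h𝔪.isCompl hw]

/-- The pullback to the Lie algebra of the metric at the origin. -/
noncomputable def originInner (EG : Type*) [NormedAddCommGroup EG] [NormedSpace ℝ EG]
    {G : Type*} [TopologicalSpace G] [ChartedSpace EG G] [Group G]
    {EM : Type*} [NormedAddCommGroup EM] [NormedSpace ℝ EM]
    {H : Subgroup G} [ChartedSpace EM (G ⧸ H)] [IsManifold 𝓘(ℝ, EM) ∞ (G ⧸ H)]
    (a : RiemannianMetricOn EM (G ⧸ H)) : EG →L[ℝ] EG →L[ℝ] ℝ :=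
  ContinuousLinearMap.bilinearComp (E := EM) (F := EM) (a.inner (origin H))
    (originDeriv EG EM H) (originDeriv EG EM H)

theorem originInner_apply (a : RiemannianMetricOn EM (G ⧸ H)) (u v : EG) :
    originInner EG a u v =
      a.inner (origin H) (originDeriv EG EM H u) (originDeriv EG EM H v) := rfl

theorem originInner_comm (a : RiemannianMetricOn EM (G ⧸ H)) (u v : EG) :
    originInner EG a u v = originInner EG a v u := a.symm _ _ _

theorem originInner_eq_zero_of_left (a : RiemannianMetricOn EM (G ⧸ H)) {u : EG}
    (hu : originDeriv EG EM H u = 0) (v : EG) : originInner EG a u v = 0 := by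
  rw [originInner_apply, hu]
  exact congrArg (fun L : EM →L[ℝ] ℝ => L (originDeriv EG EM H v))
    (map_zero (a.inner (origin H)))

theorem originInner_add_add (a : RiemannianMetricOn EM (G ⧸ H)) (u v p q : EG) :
    originInner EG a (u + v) (p + q) = originInner EG a u p + originInner EG a u q
      + (originInner EG a v p + originInner EG a v q) := by
  simp only [map_add, add_apply]
  ring

/-- The norm is pulled back to all of `𝔤`, where the form degenerates along `𝔥`; the pair condition
therefore asks for the bound only where the form is positive. -/
theorem isAlphaBetaPair_originInner (hXb : ∀ x, √(a.inner x (X x) (X x)) < b₀) :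
    IsAlphaBetaPair (originInner EG a)
      ((dualForm a X (origin H)).comp (originDeriv EG EM H)) b₀ :=
  ⟨originInner_comm a, fun y hy =>
    (isAlphaBetaPair_inner (a := a) hXb (origin H)).bound (originDeriv EG EM H y) hy⟩

theorem originDeriv_bracketM (hM : IsHomogeneousManifold EG EM H)
    {𝔪 : Submodule ℝ (LieAlg EG G)} (h𝔪 : IsReductiveDecomposition H 𝔪)
    (x y : LieAlg EG G) :
    originDeriv EG EM H (bracketM h𝔪 x y) = originDeriv EG EM H (⁅x, y⁆ : LieAlg EG G) :=
  originDeriv_projection hM h𝔪 _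

/-- The Latifi condition for the decomposition `𝔤 = 𝔥 ⊕ 𝔪`. -/
def IsLatifiNaturallyReductiveWith (F : (x : G ⧸ H) → TangentSpace 𝓘(ℝ, EM) x → ℝ)
    {𝔪 : Submodule ℝ (LieAlg EG G)} (h𝔪 : IsReductiveDecomposition H 𝔪) : Prop :=
  ∀ y ∈ 𝔪, y ≠ 0 → ∀ x ∈ 𝔪, ∀ u ∈ 𝔪, ∀ v ∈ 𝔪,
    fundamentalTensor (fun w => F (origin H) (toTangent EM H w)) y (bracketM h𝔪 x u) v
      + fundamentalTensor (fun w => F (origin H) (toTangent EM H w)) y u (bracketM h𝔪 x v)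
      + 2 * cartanTensor (fun w => F (origin H) (toTangent EM H w)) y (bracketM h𝔪 x y) u v
      = 0

theorem IsRiemannNaturallyReductiveWith.isLatifi [FiniteDimensional ℝ EG] [FiniteDimensional ℝ EM]
    (hM : IsHomogeneousManifold EG EM H) (hφ : IsAlphaBetaFunction φ b₀)
    (hXb : ∀ x, √(a.inner x (X x) (X x)) < b₀)
    (hω : ∀ y z : LieAlg EG G,
      dualForm a X (origin H) (originDeriv EG EM H (⁅y, z⁆ : LieAlg EG G)) = 0)
    {𝔪 : Submodule ℝ (LieAlg EG G)} {h𝔪 : IsReductiveDecomposition H 𝔪}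
    (h : IsRiemannNaturallyReductiveWith a h𝔪) :
    IsLatifiNaturallyReductiveWith (alphaBetaMetric a X φ) h𝔪 := by
  intro y hy hy0 x hx u hu v hv
  have hpos : 0 < originInner EG a y y :=
    a.pos (origin H) _ (originDeriv_ne_zero hM h𝔪 hy hy0)
  have key := (isAlphaBetaPair_originInner (EG := EG) hXb).tensor_invariance hφ hpos
    (bracketMap h𝔪 x) (fun w => ?_) (fun w => ?_) u v
  · have hAu := bracketMap_apply_of_mem h𝔪 x hu
    have hAv := bracketMap_apply_of_mem h𝔪 x hv
    have hAy := bracketMap_apply_of_mem h𝔪 x hy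
    rw [hAu, hAv, hAy] at key
    exact key
  -- Skewness is needed on all of `𝔤`. Since `w` and `w_𝔪` have the same image in the tangent space,
  -- it reduces to (1) on `𝔪`.
  · set w' := 𝔪.projection (subgroupLieAlg H) h𝔪.isCompl w with hw'
    have hmem : w' ∈ 𝔪 := Submodule.projection_apply_mem h𝔪.isCompl w
    have h1 : originInner EG a (bracketM h𝔪 x w') w' + originInner EG a w' (bracketM h𝔪 x w') = 0 :=
      h x hx w' hmem w' hmem
    have h2 : originInner EG a w (bracketMap h𝔪 x w) = originInner EG a w' (bracketM h𝔪 x w') :=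
      congrArg (fun s : EM => a.inner (origin H) s (originDeriv EG EM H (bracketM h𝔪 x w')))
        (originDeriv_projection hM h𝔪 w).symm
    have h3 := originInner_comm (EG := EG) a (bracketM h𝔪 x w') w'
    rw [h2]
    linarith
  · exact (congrArg (dualForm a X (origin H)) (originDeriv_bracketM hM h𝔪 x _)).trans (hω _ _)

theorem IsLatifiNaturallyReductiveWith.isRiemann [FiniteDimensional ℝ EG]
    (hM : IsHomogeneousManifold EG EM H) (hφ : IsAlphaBetaFunction φ b₀)
    (hXb : ∀ x, √(a.inner x (X x) (X x)) < b₀)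
    (hω : ∀ y z : LieAlg EG G,
      dualForm a X (origin H) (originDeriv EG EM H (⁅y, z⁆ : LieAlg EG G)) = 0)
    {𝔪 : Submodule ℝ (LieAlg EG G)} {h𝔪 : IsReductiveDecomposition H 𝔪}
    (h : IsLatifiNaturallyReductiveWith (alphaBetaMetric a X φ) h𝔪) :
    IsRiemannNaturallyReductiveWith a h𝔪 := by
  have : CompleteSpace EG := FiniteDimensional.complete ℝ EG
  intro x hx y hy z hz
  have key : ∀ y ∈ 𝔪, originInner EG a y (bracketM h𝔪 x y) = 0 := by
    intro y hy
    by_cases hT : originDeriv EG EM H y = 0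
    · exact originInner_eq_zero_of_left a hT _
    have hpair := isAlphaBetaPair_originInner (EG := EG) hXb
    have hpos : 0 < originInner EG a y y := a.pos (origin H) _ hT
    have hy0 : y ≠ 0 := by
      rintro rfl
      exact hT (map_zero _)
    -- With `u = v = y`, Latifi's expression contracts to the derivative of `F²` at `y` along `[x,
    -- y]_𝔪`.
    have h1 := h y hy hy0 x hx y hy y hy
    have h2 := hpair.fundamentalTensor_contraction hφ hpos (bracketM h𝔪 x y)
    exact hpair.apply_eq_zero_of_fderiv_sq hφ hpos
      ((congrArg (dualForm a X (origin H)) (originDeriv_bracketM hM h𝔪 x y)).trans (hω _ _))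
      (h2.symm.trans h1)
  -- Polarization of the quadratic identity in `y`.
  have h1 := key (y + z) (𝔪.add_mem hy hz)
  have h2 := key y hy
  have h3 := key z hz
  have h4 : originInner EG a (y + z) (bracketM h𝔪 x y + bracketM h𝔪 x z) =
      originInner EG a y (bracketM h𝔪 x y) + originInner EG a y (bracketM h𝔪 x z)
        + (originInner EG a z (bracketM h𝔪 x y) + originInner EG a z (bracketM h𝔪 x z)) :=
    originInner_add_add (EG := EG) a y z _ _
  rw [bracketM_add] at h1
  have h5 := originInner_comm (EG := EG) a z (bracketM h𝔪 x y)
  have h6 : originInner EG a (bracketM h𝔪 x y) z + originInner EG a y (bracketM h𝔪 x z) = 0 := by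
    have h7 := h4.symm.trans h1
    linarith
  exact h6

end NaturallyReductive

end HomogeneousFinsler

theorem mainTheorem1
    {EG : Type*} [NormedAddCommGroup EG] [NormedSpace ℝ EG] [FiniteDimensional ℝ EG]
    {G : Type*} [TopologicalSpace G] [ChartedSpace EG G] [Group G] [LieGroup 𝓘(ℝ, EG) ∞ G]
    (H : Subgroup G) (hH : IsClosed (H : Set G))
    {EM : Type*} [NormedAddCommGroup EM] [NormedSpace ℝ EM] [FiniteDimensional ℝ EM]
    [ChartedSpace EM (G ⧸ H)] [IsManifold 𝓘(ℝ, EM) ∞ (G ⧸ H)]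
    (hM : HomogeneousFinsler.IsHomogeneousManifold EG EM H)
    (a : HomogeneousFinsler.RiemannianMetricOn EM (G ⧸ H))
    (ha : HomogeneousFinsler.IsInvariantMetric a)
    (X : (x : G ⧸ H) → TangentSpace 𝓘(ℝ, EM) x)
    (hXsmooth : ContMDiff 𝓘(ℝ, EM) 𝓘(ℝ, EM).tangent ∞
      (fun x => (⟨x, X x⟩ : TangentBundle 𝓘(ℝ, EM) (G ⧸ H))))
    (hX : HomogeneousFinsler.IsInvariantField X)
    (φ : ℝ → ℝ) (b₀ : ℝ) (hφ : HomogeneousFinsler.IsAlphaBetaFunction φ b₀)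
    (hXb : ∀ x : G ⧸ H, √(a.inner x (X x) (X x)) < b₀)
    (hconn : HomogeneousFinsler.ChernEqLeviCivita
      (HomogeneousFinsler.alphaBetaMetric a X φ) a)
    (hφ' : ∀ y : TangentSpace 𝓘(ℝ, EM) (HomogeneousFinsler.origin H), y ≠ 0 →
      deriv φ (HomogeneousFinsler.betaRatio a X (HomogeneousFinsler.origin H) y) ≠ 0) :
    (HomogeneousFinsler.IsLatifiNaturallyReductive EG
        (HomogeneousFinsler.alphaBetaMetric a X φ) ↔
      HomogeneousFinsler.IsRiemannNaturallyReductive EG a) ∧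
    ∀ (𝔪 : Submodule ℝ (HomogeneousFinsler.LieAlg EG G))
      (h𝔪 : HomogeneousFinsler.IsReductiveDecomposition H 𝔪),
      HomogeneousFinsler.IsRiemannNaturallyReductiveWith a h𝔪 →
      ∀ y ∈ 𝔪, ∀ z ∈ 𝔪,
        a.inner (HomogeneousFinsler.origin H) (X (HomogeneousFinsler.origin H))
          (HomogeneousFinsler.toTangent EM H (HomogeneousFinsler.bracketM h𝔪 y z)) = 0 := by
  obtain ⟨D, hLC, hC⟩ := hconn
  have hXd := (hXsmooth (HomogeneousFinsler.origin H)).mdifferentiableAt (by simp)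
  have hω := HomogeneousFinsler.dualForm_bracket_eq_zero hM ha hX hLC hXd
    (HomogeneousFinsler.covariantDerivative_eq_zero hφ hXb hLC hC hXd hφ')
  refine ⟨⟨?_, ?_⟩, ?_⟩
  · rintro ⟨𝔪, h𝔪, h⟩
    exact ⟨𝔪, h𝔪, HomogeneousFinsler.IsLatifiNaturallyReductiveWith.isRiemann hM hφ hXb hω h⟩
  · rintro ⟨𝔪, h𝔪, h⟩
    exact ⟨𝔪, h𝔪, HomogeneousFinsler.IsRiemannNaturallyReductiveWith.isLatifi hM hφ hXb hω h⟩
  · intro 𝔪 h𝔪 _ y _ z _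
    exact (congrArg (HomogeneousFinsler.dualForm a X (HomogeneousFinsler.origin H))
      (HomogeneousFinsler.originDeriv_bracketM hM h𝔪 y z)).trans (hω y z)
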